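/- Let $w$ be real with $0\le w\le 1$ and let $\zeta$ be the Riemann zeta function. Powers of $w$ at $w=0$ are read as $0^s=0$ for $\Re s>0$ (the integrand at the single point $v=0$ is immaterial), and $w^{1/4}\ln w$ is read as its limit $0$ at $w=0$. (1) Let $a<0$ be real with $a\notin\{-1,-2,-3,\dots\}$. Then the integral and the infinite series below converge absolutely, and $$\int_{-\infty}^{\infty}\frac{w^{v^2+iv}}{\zeta(4av(v+i))\cosh(\pi v)}\,dv=\frac{w^{1/4}}{\zeta(a)}+\frac{\pi}{2}\sum_{n=\lceil -a/2\rceil}^{\infty}\frac{w^{-n/(2a)}}{\zeta'(-2n)\,\sqrt{-a^2-2an}\;\sinh\!\Big(\frac{\pi\sqrt{-a^2-2an}}{2a}\Big)}-\frac{\pi}{2}\sum_{n=1}^{\lfloor -a/2\rfloor}\frac{w^{-n/(2a)}}{\zeta'(-2n)\,\sqrt{a^2+2an}\;\sin\!\Big(\frac{\pi\sqrt{a^2+2an}}{2a}\Big)}.$$ (2) Let $a=-2m$ with $m\ge 1$ an integer. Then the integral and the infinite series below converge absolutely, and $$\int_{-\infty}^{\infty}\frac{w^{v^2+iv}}{\zeta(-8mv(v+i))\cosh(\pi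 v)}\,dv=-\frac18\,\frac{w^{1/4}\ln w}{m\,\zeta'(-2m)}+\frac{1}{48}\,\frac{\pi^2w^{1/4}}{m\,\zeta'(-2m)}-\frac12\,\frac{w^{1/4}\,\zeta''(-2m)}{\zeta'(-2m)^2}$$ $$-\frac{\pi}{4\sqrt m}\sum_{n=0}^{\infty}\frac{w^{(n+1+m)/(4m)}}{\sqrt{n+1}\;\zeta'(-2n-2m-2)\,\sinh\!\Big(\frac{\pi\sqrt{1+n}}{2\sqrt m}\Big)}+\frac{\pi}{4}\sum_{n=1}^{m-1}\frac{w^{n/(4m)}}{\zeta'(-2n)\,\sqrt{m^2-mn}\;\sin\!\Big(\frac{\pi}{2}\sqrt{1-n/m}\Big)}.$$ -/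

import Mathlib

noncomputable section

/-- The integrand `w^(v² + i v) / (ζ(4 a v (v + i)) cosh(π v))`, for real `a`, `w`, `v`. -/
def zetaKernel (a w v : ℝ) : ℂ :=
  (w : ℂ) ^ ((v : ℂ) ^ 2 + Complex.I * (v : ℂ)) /
    (riemannZeta (4 * (a : ℂ) * (v : ℂ) * ((v : ℂ) + Complex.I)) *
      Complex.cosh ((Real.pi : ℂ) * (v : ℂ)))

/-- `w^(-n/(2a)) / (ζ'(-2n) √(-a² - 2an) sinh(π √(-a² - 2an) / (2a)))`. -/
def sinhTerm (a w : ℝ) (n : ℕ) : ℂ :=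
  ((w ^ (-(n : ℝ) / (2 * a)) : ℝ) : ℂ) /
    (deriv riemannZeta (-2 * (n : ℂ)) *
      ((Real.sqrt (-a ^ 2 - 2 * a * n) *
        Real.sinh (Real.pi * Real.sqrt (-a ^ 2 - 2 * a * n) / (2 * a)) : ℝ) : ℂ))

/-- `w^(-n/(2a)) / (ζ'(-2n) √(a² + 2an) sin(π √(a² + 2an) / (2a)))`. -/
def sinTerm (a w : ℝ) (n : ℕ) : ℂ :=
  ((w ^ (-(n : ℝ) / (2 * a)) : ℝ) : ℂ) /
    (deriv riemannZeta (-2 * (n : ℂ)) *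
      ((Real.sqrt (a ^ 2 + 2 * a * n) *
        Real.sin (Real.pi * Real.sqrt (a ^ 2 + 2 * a * n) / (2 * a)) : ℝ) : ℂ))

/-- `w^((n+1+m)/(4m)) / (√(n+1) ζ'(-2n-2m-2) sinh(π √(1+n) / (2 √m)))`. -/
def limitSinhTerm (m : ℕ) (w : ℝ) (n : ℕ) : ℂ :=
  ((w ^ (((n : ℝ) + 1 + m) / (4 * m)) : ℝ) : ℂ) /
    (((Real.sqrt ((n : ℝ) + 1) : ℝ) : ℂ) *
      deriv riemannZeta (-2 * (n : ℂ) - 2 * (m : ℂ) - 2) *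
      ((Real.sinh (Real.pi * Real.sqrt (1 + (n : ℝ)) / (2 * Real.sqrt m)) : ℝ) : ℂ))

/-- `w^(n/(4m)) / (ζ'(-2n) √(m² - mn) sin((π/2) √(1 - n/m)))`. -/
def limitSinTerm (m : ℕ) (w : ℝ) (n : ℕ) : ℂ :=
  ((w ^ ((n : ℝ) / (4 * m)) : ℝ) : ℂ) /
    (deriv riemannZeta (-2 * (n : ℂ)) *
      ((Real.sqrt ((m : ℝ) ^ 2 - m * n) *
        Real.sin (Real.pi / 2 * Real.sqrt (1 - (n : ℝ) / m)) : ℝ) : ℂ))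

end

/-! In the variable z = v + i/2 the integrand becomes K(z) = i w^(z² + 1/4) / (ζ(a(4z² + 1))
sinh(πz)), an odd function, and the real line becomes the upper edge of the strip |Im z| ≤ 1/2. By
oddness both horizontal edges of the rectangle [-R, R] × [-1/2, 1/2] contribute equally, so the
residue theorem gives ∫ = -πi Σ Res K once the vertical edges vanish as R → ∞.

For a < 0 the map z ↦ a(4z² + 1) sends the strip into Re s ≤ 0, where ζ vanishes only at -2n, n ≥ 1.
The poles are therefore 0 and the pairs ±p_n with a(4p_n² + 1) = -2n: real for 2n > -a (the sinh
terms), purely imaginary for 2n < -a (the sin terms). The two members of a pair have the same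
residue. If a = -2m, the pair ±p_m collapses into the zero of sinh, and 0 becomes a triple pole
whose residue carries ln w, π² and ζ''(-2m).

The estimates rest on the functional equation ζ(1 - t) = A(t) cos(πt/2). Factorial decay of 1/Γ
makes 1/A exponentially small for |Im t| ≤ Re t + B (`exists_norm_inv_zetaFactor_le`), so 1/ζ is
bounded wherever the cosine stays away from 0. This controls the integrand, the vertical edges for
well-chosen R (`exists_norm_stripKernel_vertical_le`) and 1/ζ'(-2n). Both cases then come from
`integral_zetaKernel_eq`, which takes the local expansion at 0 as a hypothesis. -/

section

open MeasureTheory Filter Topology Complex Set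
open scoped Interval

/-! ### Contour integrals over rectangles and the residue theorem. -/

/-- The integral of `f` along the positively oriented boundary of the rectangle with corners `z`
and `w`. -/
noncomputable def rectIntegral (f : ℂ → ℂ) (z w : ℂ) : ℂ :=
  (∫ x : ℝ in z.re..w.re, f (x + z.im * I)) - (∫ x : ℝ in z.re..w.re, f (x + w.im * I)) +
    I • (∫ y : ℝ in z.im..w.im, f (w.re + y * I)) - I • ∫ y : ℝ in z.im..w.im, f (z.re + y * I)

/-- The boundary of the rectangle with corners `z` and `w`. -/
def rectFrame (z w : ℂ) : Set ℂ :=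
  ([[z.re, w.re]] ×ℂ {z.im, w.im}) ∪ ({z.re, w.re} ×ℂ [[z.im, w.im]])

lemma bottom_mem_rectFrame {z w : ℂ} {x : ℝ} (hx : x ∈ [[z.re, w.re]]) :
    (x + z.im * I : ℂ) ∈ rectFrame z w := by
  left; simp [mem_reProdIm, hx]

lemma top_mem_rectFrame {z w : ℂ} {x : ℝ} (hx : x ∈ [[z.re, w.re]]) :
    (x + w.im * I : ℂ) ∈ rectFrame z w := by
  left; simp [mem_reProdIm, hx]

lemma left_mem_rectFrame {z w : ℂ} {y : ℝ} (hy : y ∈ [[z.im, w.im]]) :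
    (z.re + y * I : ℂ) ∈ rectFrame z w := by
  right; simp [mem_reProdIm, hy]

lemma right_mem_rectFrame {z w : ℂ} {y : ℝ} (hy : y ∈ [[z.im, w.im]]) :
    (w.re + y * I : ℂ) ∈ rectFrame z w := by
  right; simp [mem_reProdIm, hy]

lemma rectFrame_subset (z w : ℂ) : rectFrame z w ⊆ [[z.re, w.re]] ×ℂ [[z.im, w.im]] := by
  rintro x (⟨h1, h2⟩ | ⟨h1, h2⟩)
  · refine ⟨h1, ?_⟩
    rcases h2 with h | h
    · simp_all
    · simp_all
  · refine ⟨?_, h2⟩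
    rcases h1 with h | h
    · simp_all
    · simp_all

lemma notMem_rectFrame {z w p : ℂ} (hp : p ∈ Ioo z.re w.re ×ℂ Ioo z.im w.im) :
    p ∉ rectFrame z w := by
  obtain ⟨⟨h1, h2⟩, h3, h4⟩ := hp
  rintro (⟨-, h⟩ | ⟨h, -⟩) <;> rcases h with h | h <;> simp_all

lemma intervalIntegrable_sides {f : ℂ → ℂ} {z w : ℂ} (hf : ContinuousOn f (rectFrame z w)) :
    IntervalIntegrable (fun x : ℝ => f (x + z.im * I)) volume z.re w.re ∧
    IntervalIntegrable (fun x : ℝ => f (x + w.im * I)) volume z.re w.re ∧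
    IntervalIntegrable (fun y : ℝ => f (w.re + y * I)) volume z.im w.im ∧
    IntervalIntegrable (fun y : ℝ => f (z.re + y * I)) volume z.im w.im := by
  refine ⟨?_, ?_, ?_, ?_⟩ <;> apply ContinuousOn.intervalIntegrable
  · exact hf.comp (by fun_prop) fun x hx => bottom_mem_rectFrame hx
  · exact hf.comp (by fun_prop) fun x hx => top_mem_rectFrame hx
  · exact hf.comp (by fun_prop) fun x hx => right_mem_rectFrame hx
  · exact hf.comp (by fun_prop) fun x hx => left_mem_rectFrame hx

lemma rectIntegral_congr {f g : ℂ → ℂ} {z w : ℂ} (h : EqOn f g (rectFrame z w)) :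
    rectIntegral f z w = rectIntegral g z w := by
  unfold rectIntegral
  rw [intervalIntegral.integral_congr fun x hx => h (bottom_mem_rectFrame hx),
    intervalIntegral.integral_congr fun x hx => h (top_mem_rectFrame hx),
    intervalIntegral.integral_congr fun x hx => h (left_mem_rectFrame hx),
    intervalIntegral.integral_congr fun x hx => h (right_mem_rectFrame hx)]

lemma rectIntegral_add {f g : ℂ → ℂ} {z w : ℂ} (hf : ContinuousOn f (rectFrame z w))
    (hg : ContinuousOn g (rectFrame z w)) :
    rectIntegral (fun s => f s + g s) z w = rectIntegral f z w + rectIntegral g z w := by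
  obtain ⟨f1, f2, f3, f4⟩ := intervalIntegrable_sides hf
  obtain ⟨g1, g2, g3, g4⟩ := intervalIntegrable_sides hg
  unfold rectIntegral
  rw [intervalIntegral.integral_add f1 g1, intervalIntegral.integral_add f2 g2,
    intervalIntegral.integral_add f3 g3, intervalIntegral.integral_add f4 g4]
  simp only [smul_eq_mul]
  ring

lemma rectIntegral_const_mul (c : ℂ) (f : ℂ → ℂ) (z w : ℂ) :
    rectIntegral (fun s => c * f s) z w = c * rectIntegral f z w := by
  unfold rectIntegral
  simp only [intervalIntegral.integral_const_mul, smul_eq_mul]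
  ring

lemma rectIntegral_sum {ι : Type*} (S : Finset ι) {f : ι → ℂ → ℂ} {z w : ℂ}
    (hf : ∀ i ∈ S, ContinuousOn (f i) (rectFrame z w)) :
    rectIntegral (fun s => ∑ i ∈ S, f i s) z w = ∑ i ∈ S, rectIntegral (f i) z w := by
  classical
  induction S using Finset.induction_on with
  | empty => simp [rectIntegral]
  | insert i S hi ih =>
    simp only [Finset.sum_insert hi]
    rw [rectIntegral_add (hf i (Finset.mem_insert_self ..))
      (continuousOn_finsetSum _ fun j hj => hf j (Finset.mem_insert_of_mem hj)),
      ih fun j hj => hf j (Finset.mem_insert_of_mem hj)]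

/-- A function with a primitive has integral equal to the increment of the primitive, on
horizontal segments. -/
lemma integral_horizontal {f g : ℂ → ℂ} {a b y : ℝ}
    (h : ∀ x ∈ [[a, b]], HasDerivAt g (f (x + y * I)) (x + y * I))
    (hf : ContinuousOn (fun x : ℝ => f (x + y * I)) [[a, b]]) :
    ∫ x : ℝ in a..b, f (x + y * I) = g (b + y * I) - g (a + y * I) := by
  refine intervalIntegral.integral_eq_sub_of_hasDerivAt
    (f := fun x : ℝ => g (x + y * I)) (fun x hx => ?_) hf.intervalIntegrable
  have h1 : HasDerivAt (fun x : ℝ => (x + y * I : ℂ)) 1 x :=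
    (HasDerivAt.ofReal_comp (hasDerivAt_id x)).add_const _
  have h2 := (h x hx).comp x h1
  rwa [mul_one] at h2

lemma integral_vertical {f g : ℂ → ℂ} {a b x : ℝ}
    (h : ∀ y ∈ [[a, b]], HasDerivAt g (f (x + y * I)) (x + y * I))
    (hf : ContinuousOn (fun y : ℝ => f (x + y * I)) [[a, b]]) :
    I • ∫ y : ℝ in a..b, f (x + y * I) = g (x + b * I) - g (x + a * I) := by
  rw [smul_eq_mul, ← intervalIntegral.integral_const_mul]
  refine intervalIntegral.integral_eq_sub_of_hasDerivAt
    (f := fun y : ℝ => g (x + y * I)) (fun y hy => ?_)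
    (continuousOn_const.mul hf).intervalIntegrable
  have h1 : HasDerivAt (fun y : ℝ => (x + y * I : ℂ)) I y := by
    simpa using ((HasDerivAt.ofReal_comp (hasDerivAt_id y)).mul_const I).const_add (x : ℂ)
  have h2 := (h y hy).comp y h1
  rwa [mul_comm] at h2

lemma rectIntegral_eq_zero_of_primitive {f g : ℂ → ℂ} {z w : ℂ}
    (hg : ∀ s ∈ rectFrame z w, HasDerivAt g (f s) s) (hf : ContinuousOn f (rectFrame z w)) :
    rectIntegral f z w = 0 := by
  unfold rectIntegral
  rw [integral_horizontal (fun x hx => hg _ (bottom_mem_rectFrame hx))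
      (hf.comp (by fun_prop) fun x hx => bottom_mem_rectFrame hx),
    integral_horizontal (fun x hx => hg _ (top_mem_rectFrame hx))
      (hf.comp (by fun_prop) fun x hx => top_mem_rectFrame hx),
    integral_vertical (fun x hx => hg _ (right_mem_rectFrame hx))
      (hf.comp (by fun_prop) fun x hx => right_mem_rectFrame hx),
    integral_vertical (fun x hx => hg _ (left_mem_rectFrame hx))
      (hf.comp (by fun_prop) fun x hx => left_mem_rectFrame hx)]
  ring

lemma continuousOn_inv_sub {z w p : ℂ} (hp : p ∈ Ioo z.re w.re ×ℂ Ioo z.im w.im) :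
    ContinuousOn (fun s : ℂ => (s - p)⁻¹) (rectFrame z w) := by
  refine ContinuousOn.inv₀ (by fun_prop) fun s hs h => notMem_rectFrame hp ?_
  rwa [← sub_eq_zero.mp h]

/-- The principal logarithm of `s - p` is a primitive on the bottom, right and top edges, but the
left edge crosses its cut, so `log (-(s - p))` serves there. The branches differ by `πi` and `-πi`
at the two left corners; this mismatch is the value `2πi`. -/
lemma rectIntegral_inv_sub {z w p : ℂ} (hp : p ∈ Ioo z.re w.re ×ℂ Ioo z.im w.im) :
    rectIntegral (fun s => (s - p)⁻¹) z w = 2 * Real.pi * I := by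
  have hf := continuousOn_inv_sub hp
  obtain ⟨⟨h1, h2⟩, h3, h4⟩ := hp
  have hlog : ∀ s : ℂ, s - p ∈ slitPlane → HasDerivAt (fun s => log (s - p)) ((s - p)⁻¹) s := by
    intro s hs
    simpa using ((hasDerivAt_id s).sub_const p).clog hs
  have hlog' : ∀ s : ℂ, -(s - p) ∈ slitPlane →
      HasDerivAt (fun s => log (-(s - p))) ((s - p)⁻¹) s := by
    intro s hs
    have h5 : HasDerivAt (fun s => -(s - p)) (-1) s := ((hasDerivAt_id s).sub_const p).neg
    have := h5.clog hs
    rwa [neg_div_neg_eq, one_div] at this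
  unfold rectIntegral
  rw [integral_horizontal (f := fun s => (s - p)⁻¹)
      (fun x hx => hlog _ (Or.inr (by simpa using (sub_neg.mpr h3).ne)))
      (hf.comp (by fun_prop) fun x hx => bottom_mem_rectFrame hx),
    integral_horizontal (f := fun s => (s - p)⁻¹)
      (fun x hx => hlog _ (Or.inr (by simpa using (sub_pos.mpr h4).ne')))
      (hf.comp (by fun_prop) fun x hx => top_mem_rectFrame hx),
    integral_vertical (f := fun s => (s - p)⁻¹)
      (fun x hx => hlog _ (Or.inl (by simpa using h2)))
      (hf.comp (by fun_prop) fun x hx => right_mem_rectFrame hx),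
    integral_vertical (f := fun s => (s - p)⁻¹)
      (fun x hx => hlog' _ (Or.inl (by simpa using h1)))
      (hf.comp (by fun_prop) fun x hx => left_mem_rectFrame hx)]
  have hA : log (-((z.re + w.im * I : ℂ) - p)) =
      log ((z.re + w.im * I : ℂ) - p) - Real.pi * I := by
    simp only [log, norm_neg]
    rw [arg_neg_eq_arg_sub_pi_of_im_pos (by simpa using h4)]
    push_cast; ring
  have hB : log (-((z.re + z.im * I : ℂ) - p)) =
      log ((z.re + z.im * I : ℂ) - p) + Real.pi * I := by
    simp only [log, norm_neg]
    rw [arg_neg_eq_arg_add_pi_of_im_neg (by simpa using h3)]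
    push_cast; ring
  rw [hA, hB]
  ring

/-- The residue theorem on a rectangle, for finitely many simple poles. -/
theorem rectIntegral_eq_sum_residues {f : ℂ → ℂ} {z w : ℂ} (S : Finset ℂ) (res : ℂ → ℂ)
    (hS : ∀ p ∈ S, p ∈ Ioo z.re w.re ×ℂ Ioo z.im w.im)
    (hf : ∀ s ∈ [[z.re, w.re]] ×ℂ [[z.im, w.im]], s ∉ S → DifferentiableAt ℂ f s)
    (hres : ∀ p ∈ S, Tendsto (fun s => (s - p) * f s) (𝓝[≠] p) (𝓝 (res p))) :
    rectIntegral f z w = 2 * Real.pi * I * ∑ p ∈ S, res p := by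
  classical
  -- Subtracting the principal parts leaves removable singularities; `G` fills them in by limits, so
  -- Cauchy's theorem applies to it.
  set g : ℂ → ℂ := fun s => f s - ∑ p ∈ S, res p * (s - p)⁻¹ with hg
  set G : ℂ → ℂ := fun s => if s ∈ S then limUnder (𝓝[≠] s) g else g s with hG
  have hgd : ∀ s ∈ [[z.re, w.re]] ×ℂ [[z.im, w.im]], s ∉ S → DifferentiableAt ℂ g s := by
    intro s hs hsS
    refine (hf s hs hsS).sub (DifferentiableAt.fun_sum fun p hp => ?_)
    refine ((differentiableAt_id.sub_const p).inv ?_).const_mul _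
    exact sub_ne_zero.mpr fun h : s = p => hsS (h ▸ hp)
  have hev : ∀ p : ℂ, ∀ᶠ s in 𝓝[≠] p, s ∉ S := by
    intro p
    have : ((S.erase p : Finset ℂ) : Set ℂ)ᶜ ∈ 𝓝 p :=
      (S.erase p).finite_toSet.isClosed.isOpen_compl.mem_nhds (by simp)
    filter_upwards [mem_nhdsWithin_of_mem_nhds this, self_mem_nhdsWithin] with s hs hsp
    exact fun h => hs (Finset.mem_coe.mpr (Finset.mem_erase.mpr ⟨hsp, h⟩))
  have hGd : DifferentiableOn ℂ G ([[z.re, w.re]] ×ℂ [[z.im, w.im]]) := by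
    intro s hs
    refine DifferentiableAt.differentiableWithinAt ?_
    by_cases hsS : s ∈ S
    · have hint : Ioo z.re w.re ×ℂ Ioo z.im w.im ∈ 𝓝 s :=
        (isOpen_Ioo.reProdIm isOpen_Ioo).mem_nhds (hS s hsS)
      have hsub : Ioo z.re w.re ×ℂ Ioo z.im w.im ⊆ [[z.re, w.re]] ×ℂ [[z.im, w.im]] := by
        rintro x ⟨⟨h1, h2⟩, h3, h4⟩
        exact ⟨mem_uIcc_of_le h1.le h2.le, mem_uIcc_of_le h3.le h4.le⟩
      obtain ⟨U, hU, hUd⟩ : ∃ U ∈ 𝓝 s, DifferentiableOn ℂ g (U \ {s}) := by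
        have := hev s
        rw [eventually_nhdsWithin_iff] at this
        refine ⟨_, inter_mem hint this, fun x hx => ?_⟩
        exact (hgd x (hsub hx.1.1) (hx.1.2 hx.2)).differentiableWithinAt
      have hlim : Tendsto (fun x => (x - s) * g x) (𝓝[≠] s) (𝓝 0) := by
        have h2 : Tendsto (fun x => ∑ p ∈ S.erase s, res p * ((x - s) * (x - p)⁻¹)) (𝓝[≠] s)
            (𝓝 (∑ p ∈ S.erase s, res p * ((s - s) * (s - p)⁻¹))) := by
          refine (tendsto_finsetSum _ fun p hp => ?_)
          have hne : s - p ≠ 0 := sub_ne_zero.mpr (Finset.ne_of_mem_erase hp).symm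
          have : ContinuousAt (fun x => res p * ((x - s) * (x - p)⁻¹)) s := by
            fun_prop (disch := exact hne)
          exact this.tendsto.mono_left nhdsWithin_le_nhds
        have h3 := ((hres s hsS).sub (tendsto_const_nhds (x := res s))).sub h2
        simp only [sub_self, zero_mul, mul_zero, Finset.sum_const_zero] at h3
        refine h3.congr' ?_
        filter_upwards [self_mem_nhdsWithin] with x hx
        have hx' : x - s ≠ 0 := sub_ne_zero.mpr hx
        rw [hg]
        simp only
        rw [← Finset.add_sum_erase S _ hsS, mul_sub, mul_add, Finset.mul_sum]
        have : ∀ p, (x - s) * (res p * (x - p)⁻¹) = res p * ((x - s) * (x - p)⁻¹) :=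
          fun p => by ring
        simp only [this, mul_inv_cancel₀ hx', mul_one]
        ring
      -- The form of the hypothesis in the removable singularity theorem; the arbitrary value `g s`
      -- disappears after multiplication by `x - s`.
      have ho : (fun x => g x - g s) =o[𝓝[≠] s] fun x => (x - s)⁻¹ := by
        have hne : ∀ᶠ x in 𝓝[≠] s, (x - s)⁻¹ = 0 → g x - g s = 0 := by
          filter_upwards [self_mem_nhdsWithin] with x hx h
          exact absurd (inv_eq_zero.mp h) (sub_ne_zero.mpr hx)
        rw [Asymptotics.isLittleO_iff_tendsto' hne]
        have h5 : Tendsto (fun x => (x - s) * g s) (𝓝[≠] s) (𝓝 0) := by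
          have : ContinuousAt (fun x => (x - s) * g s) s := by fun_prop
          simpa using this.tendsto.mono_left nhdsWithin_le_nhds
        have h6 := hlim.sub h5
        rw [sub_zero] at h6
        refine h6.congr fun x => ?_
        rw [div_inv_eq_mul]; ring
      have hd := (differentiableOn_update_limUnder_of_isLittleO hU hUd ho).differentiableAt hU
      refine hd.congr_of_eventuallyEq ?_
      have := hev s
      rw [eventually_nhdsWithin_iff] at this
      filter_upwards [this] with x hx
      by_cases hxs : x = s
      · simp [hG, hxs, hsS]
      · simp [hG, hx hxs, hxs]
    · refine (hgd s hs hsS).congr_of_eventuallyEq ?_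
      have : (S : Set ℂ)ᶜ ∈ 𝓝 s := S.finite_toSet.isClosed.isOpen_compl.mem_nhds (by simpa)
      filter_upwards [this] with x hx
      have hx' : x ∉ S := hx
      simp [hG, hx']
  have hG0 : rectIntegral G z w = 0 := integral_boundary_rect_eq_zero_of_differentiableOn G z w hGd
  have hcont : ∀ p ∈ S, ContinuousOn (fun s => res p * (s - p)⁻¹) (rectFrame z w) :=
    fun p hp => continuousOn_const.mul (continuousOn_inv_sub (hS p hp))
  have hfG : EqOn f (fun s => G s + ∑ p ∈ S, res p * (s - p)⁻¹) (rectFrame z w) := by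
    intro s hs
    have : s ∉ S := fun h => notMem_rectFrame (hS s h) hs
    simp [hG, hg, this]
  rw [rectIntegral_congr hfG, rectIntegral_add (hGd.continuousOn.mono (rectFrame_subset z w))
    (continuousOn_finsetSum _ hcont), hG0, rectIntegral_sum _ hcont, zero_add, Finset.mul_sum]
  refine Finset.sum_congr rfl fun p hp => ?_
  rw [rectIntegral_const_mul, rectIntegral_inv_sub (hS p hp)]
  ring

/-! ### Decay of 1/Γ in the right half-plane. -/

lemma norm_Gamma_le_Gamma_re {s : ℂ} (hs : 0 < s.re) : ‖Gamma s‖ ≤ Real.Gamma s.re := by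
  rw [Gamma_eq_integral hs, Real.Gamma_eq_integral hs, GammaIntegral]
  refine (norm_integral_le_integral_norm _).trans_eq ?_
  refine setIntegral_congr_fun measurableSet_Ioi fun x hx => ?_
  simp only [norm_mul, norm_cpow_eq_rpow_re_of_pos hx, norm_real, Real.norm_eq_abs,
    sub_re, one_re, Real.abs_exp]

lemma norm_sin_le_exp_abs_im (z : ℂ) : ‖sin z‖ ≤ Real.exp |z.im| := by
  have h : sin z = (exp (-z * I) - exp (z * I)) * I / 2 := rfl
  have h1 : ‖exp (-z * I)‖ ≤ Real.exp |z.im| := by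
    rw [norm_exp]; simpa using le_abs_self z.im
  have h2 : ‖exp (z * I)‖ ≤ Real.exp |z.im| := by
    rw [norm_exp]; simpa using neg_le_abs z.im
  have h3 := norm_sub_le (exp (-z * I)) (exp (z * I))
  rw [h, norm_div, norm_mul, norm_I, mul_one, Complex.norm_two]
  linarith

/-- Reflection gives `1/Γ(z) = Γ(3 - z) sin(πz) / (π (2 - z)(1 - z))`. The shift by 3 puts the Gamma
factor back into 1 ≤ Re ≤ 2, where it is at most 1 by convexity, and `|Im z| ≥ 1` keeps the
denominator at least 1 in modulus. -/
lemma norm_inv_Gamma_le_of_one_le_abs_im {z : ℂ} (h1 : 1 ≤ z.re) (h2 : z.re ≤ 2)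
    (him : 1 ≤ |z.im|) : ‖(Gamma z)⁻¹‖ ≤ Real.exp (Real.pi * |z.im|) := by
  have him0 : z.im ≠ 0 := by
    intro h; rw [h] at him; norm_num at him
  have hne : ∀ x : ℝ, (x : ℂ) - z ≠ 0 := fun x h => him0 (by simpa using congrArg im h)
  have hn : ∀ x : ℝ, 1 ≤ ‖(x : ℂ) - z‖ := fun x =>
    him.trans (by simpa using abs_im_le_norm ((x : ℂ) - z))
  have h1z : (1 : ℂ) - z ≠ 0 := by simpa using hne 1
  have h2z : (2 : ℂ) - z ≠ 0 := by simpa using hne 2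
  have hG : Gamma (3 - z) = (2 - z) * ((1 - z) * Gamma (1 - z)) := by
    rw [← Gamma_add_one _ h1z, show (1 - z + 1 : ℂ) = 2 - z by ring, ← Gamma_add_one _ h2z]
    congr 1; ring
  have hsin : sin (Real.pi * z) ≠ 0 := by
    rw [Complex.sin_ne_zero_iff]
    intro k h
    have := congrArg im h
    simp at this
    exact him0 this
  have hpi : (Real.pi : ℂ) ≠ 0 := ofReal_ne_zero.mpr Real.pi_ne_zero
  have hGz : Gamma z ≠ 0 := Gamma_ne_zero_of_re_pos (by linarith)
  have hr := Gamma_mul_Gamma_one_sub z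
  have hinv : (Gamma z)⁻¹ = Gamma (3 - z) * sin (Real.pi * z) / (Real.pi * (2 - z) * (1 - z)) := by
    have h1 : Gamma (1 - z) = Real.pi / sin (Real.pi * z) * (Gamma z)⁻¹ := by
      rw [← hr]; field_simp
    have hsin' := div_self hsin
    rw [hG, h1]
    field_simp
    rw [mul_comm z, hsin']
  have hG3 : ‖Gamma (3 - z)‖ ≤ 1 := by
    refine (norm_Gamma_le_Gamma_re (by simp; linarith)).trans ?_
    have := Real.convexOn_Gamma.le_max_of_mem_Icc (x := 1) (y := 2) (z := (3 - z).re)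
      (by simp) (by simp) ⟨by simp; linarith, by simp; linarith⟩
    simpa [Real.Gamma_one, Real.Gamma_two] using this
  have hs : ‖sin (Real.pi * z)‖ ≤ Real.exp (Real.pi * |z.im|) := by
    have := norm_sin_le_exp_abs_im (Real.pi * z)
    simpa [abs_mul, abs_of_pos Real.pi_pos] using this
  rw [hinv, norm_div, norm_mul, norm_mul, norm_mul]
  have e1 : 1 ≤ ‖(2 : ℂ) - z‖ := by simpa using hn 2
  have e2 : 1 ≤ ‖(1 : ℂ) - z‖ := by simpa using hn 1
  have e3 : 1 ≤ ‖(Real.pi : ℂ)‖ := by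
    simpa [abs_of_pos Real.pi_pos] using (by linarith [Real.pi_gt_three] : 1 ≤ Real.pi)
  have e4 : 1 ≤ ‖(Real.pi : ℂ)‖ * ‖(2 : ℂ) - z‖ * ‖(1 : ℂ) - z‖ :=
    one_le_mul_of_one_le_of_one_le (one_le_mul_of_one_le_of_one_le e3 e1) e2
  refine (div_le_self (by positivity) e4).trans ?_
  calc _ ≤ 1 * Real.exp (Real.pi * |z.im|) := by gcongr
    _ = _ := one_mul _

lemma exists_norm_inv_Gamma_le_strip :
    ∃ C : ℝ, 0 < C ∧ ∀ z : ℂ, 1 ≤ z.re → z.re ≤ 2 →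
      ‖(Gamma z)⁻¹‖ ≤ C * Real.exp (Real.pi * |z.im|) := by
  have hK : IsCompact (Icc (1 : ℝ) 2 ×ℂ Icc (-1 : ℝ) 1) := isCompact_Icc.reProdIm isCompact_Icc
  obtain ⟨C, hC⟩ := hK.exists_bound_of_continuousOn differentiable_one_div_Gamma.continuous.continuousOn
  refine ⟨max C 1, by positivity, fun z h1 h2 => ?_⟩
  have hexp : 1 ≤ Real.exp (Real.pi * |z.im|) := Real.one_le_exp (by positivity)
  rcases le_total 1 |z.im| with h | h
  · calc _ ≤ 1 * Real.exp (Real.pi * |z.im|) := by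
          rw [one_mul]; exact norm_inv_Gamma_le_of_one_le_abs_im h1 h2 h
      _ ≤ _ := by gcongr; exact le_max_right _ _
  · calc _ ≤ C := hC z ⟨⟨h1, h2⟩, abs_le.mp h⟩
      _ ≤ max C 1 * 1 := by rw [mul_one]; exact le_max_left _ _
      _ ≤ _ := by gcongr

lemma exists_norm_inv_Gamma_le_factorial :
    ∃ C : ℝ, 0 < C ∧ ∀ (N : ℕ) (z : ℂ), N + 1 ≤ z.re → z.re ≤ N + 2 →
      ‖(Gamma z)⁻¹‖ ≤ C * Real.exp (Real.pi * |z.im|) / N.factorial := by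
  obtain ⟨C, hC, h⟩ := exists_norm_inv_Gamma_le_strip
  refine ⟨C, hC, fun N => ?_⟩
  induction N with
  | zero => intro z h1 h2; simpa using h z (by simpa using h1) (by simpa using h2)
  | succ N ih =>
    intro z h1 h2
    push_cast at h1 h2
    have hN : (0 : ℝ) ≤ N := N.cast_nonneg
    have hre : (N : ℝ) + 1 ≤ (z - 1).re := by simp; linarith
    have hz : z - 1 ≠ 0 := fun h0 => by rw [h0] at hre; simp at hre; linarith
    have hG : Gamma z = (z - 1) * Gamma (z - 1) := by
      rw [← Gamma_add_one _ hz, sub_add_cancel]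
    have h3 := ih (z - 1) hre (by simp; linarith)
    have h4 : (N : ℝ) + 1 ≤ ‖z - 1‖ := hre.trans (re_le_norm _)
    rw [hG, mul_inv, norm_mul, norm_inv, Nat.factorial_succ]
    push_cast
    have h5 : (z - 1).im = z.im := by simp
    rw [h5] at h3
    calc ‖z - 1‖⁻¹ * ‖(Gamma (z - 1))⁻¹‖
        ≤ ((N : ℝ) + 1)⁻¹ * (C * Real.exp (Real.pi * |z.im|) / N.factorial) := by gcongr
      _ = _ := by field_simp

/-- The factorial beats every exponential. With σ = Re t, the growth `(2π)^σ e^(π|Im t|)` and the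
factor `e^σ` that pays for the decay amount to a constant times `e^(Dσ)`; for N = ⌊σ⌋ - 1 one has
`e^(DN) / N! ≤ exp(e^D)`. -/
lemma exists_two_pi_rpow_mul_norm_inv_Gamma_le (B : ℝ) :
    ∃ M : ℝ, 0 < M ∧ ∀ t : ℂ, 1 ≤ t.re → |t.im| ≤ t.re + B →
      (2 * Real.pi) ^ t.re * ‖(Gamma t)⁻¹‖ ≤ M * Real.exp (-t.re) := by
  obtain ⟨C, hC, h⟩ := exists_norm_inv_Gamma_le_factorial
  set D : ℝ := Real.log (2 * Real.pi) + Real.pi + 1 with hD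
  have hlog : 0 ≤ Real.log (2 * Real.pi) := Real.log_nonneg (by linarith [Real.pi_gt_three])
  have hD0 : 0 ≤ D := by have := Real.pi_pos; positivity
  refine ⟨C * Real.exp (Real.pi * B) * Real.exp (2 * D) * Real.exp (Real.exp D), by positivity,
    fun t ht him => ?_⟩
  obtain ⟨N, hN⟩ : ∃ N : ℕ, ⌊t.re⌋₊ = N + 1 :=
    Nat.exists_eq_succ_of_ne_zero (Nat.floor_pos.mpr ht).ne'
  have h1 : (N : ℝ) + 1 ≤ t.re := by
    have := Nat.floor_le (zero_le_one.trans ht)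
    rw [hN] at this; exact_mod_cast this
  have h2 : t.re ≤ N + 2 := by
    have := (Nat.lt_floor_add_one t.re).le
    rw [hN] at this; push_cast at this; linarith
  have h3 := h N t h1 h2
  have h4 : Real.exp (D * N) / N.factorial ≤ Real.exp (Real.exp D) := by
    rw [mul_comm, Real.exp_nat_mul]
    exact Real.pow_div_factorial_le_exp _ (Real.exp_pos D).le N
  have h5 : (2 * Real.pi) ^ t.re = Real.exp (Real.log (2 * Real.pi) * t.re) :=
    Real.rpow_def_of_pos (by positivity) _
  have h6 : Real.pi * |t.im| ≤ Real.pi * (t.re + B) := by gcongr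
  have h7 : D * t.re ≤ D * N + 2 * D := by nlinarith
  calc (2 * Real.pi) ^ t.re * ‖(Gamma t)⁻¹‖
      ≤ Real.exp (Real.log (2 * Real.pi) * t.re) *
        (C * Real.exp (Real.pi * |t.im|) / N.factorial) := by rw [h5]; gcongr
    _ ≤ Real.exp (Real.log (2 * Real.pi) * t.re) *
        (C * Real.exp (Real.pi * (t.re + B)) / N.factorial) := by gcongr
    _ = C * Real.exp (Real.pi * B) * (Real.exp (D * t.re) / N.factorial) * Real.exp (-t.re) := by
        have : Real.log (2 * Real.pi) * t.re + Real.pi * (t.re + B) =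
          Real.pi * B + D * t.re + -t.re := by rw [hD]; ring
        have e := congrArg Real.exp this
        simp only [Real.exp_add] at e
        linear_combination C / N.factorial * e
    _ ≤ C * Real.exp (Real.pi * B) * (Real.exp (D * N + 2 * D) / N.factorial) *
        Real.exp (-t.re) := by gcongr
    _ = C * Real.exp (Real.pi * B) * Real.exp (2 * D) * (Real.exp (D * N) / N.factorial) *
        Real.exp (-t.re) := by rw [Real.exp_add]; ring
    _ ≤ _ := by gcongr

/-! ### The functional equation, trivial zeros and lower bounds for ζ. -/

/-- Comparison with ζ(2): `|ζ(t)| ≥ 1 - (π²/6 - 1) > 1/3`. -/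
lemma norm_inv_riemannZeta_le {t : ℂ} (ht : 2 ≤ t.re) : ‖(riemannZeta t)⁻¹‖ ≤ 3 := by
  have h1 : 1 < t.re := by linarith
  have hs : Summable fun n : ℕ => 1 / ((n : ℂ) + 1) ^ t := by
    have := (summable_nat_add_iff 1).mpr (summable_one_div_nat_cpow.mpr h1)
    simpa using this
  have hz := zeta_eq_tsum_one_div_nat_add_one_cpow h1
  rw [hs.tsum_eq_zero_add] at hz
  have h2 : HasSum (fun n : ℕ => 1 / ((n : ℝ) + 2) ^ 2) (Real.pi ^ 2 / 6 - 1) := by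
    have := (hasSum_nat_add_iff' 2).mpr hasSum_zeta_two
    simpa [Finset.sum_range_succ] using this
  have hb : ‖∑' n : ℕ, 1 / (((n + 1 : ℕ) : ℂ) + 1) ^ t‖ ≤ Real.pi ^ 2 / 6 - 1 := by
    refine tsum_of_norm_bounded h2 fun n => ?_
    have h3 : (((n + 1 : ℕ) : ℂ) + 1) = ((n + 2 : ℕ) : ℂ) := by push_cast; ring
    rw [h3, norm_div, norm_one, norm_natCast_cpow_of_pos (by lia)]
    have h4 : ((n : ℝ) + 2) ^ 2 = (((n + 2 : ℕ) : ℝ)) ^ (2 : ℝ) := by push_cast; norm_num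
    rw [h4]
    gcongr
    push_cast; linarith [(Nat.cast_nonneg n : (0 : ℝ) ≤ n)]
  have h0 : (1 / (((0 : ℕ) : ℂ) + 1) ^ t) = 1 := by simp
  rw [h0] at hz
  set T := ∑' n : ℕ, 1 / (((n + 1 : ℕ) : ℂ) + 1) ^ t
  have h5 : 1 / 3 ≤ ‖riemannZeta t‖ := by
    have h6 := norm_sub_le (riemannZeta t) T
    have h7 : riemannZeta t - T = 1 := by rw [hz]; ring
    rw [h7, norm_one] at h6
    nlinarith [Real.pi_lt_d2, Real.pi_gt_three]
  rw [norm_inv]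
  exact inv_le_of_inv_le₀ (by norm_num) (by linarith)

/-- The factor of the functional equation `ζ (1 - t) = zetaFactor t * cos (π t / 2)`. -/
noncomputable def zetaFactor (t : ℂ) : ℂ :=
  2 * (2 * Real.pi) ^ (-t) * Gamma t * riemannZeta t

lemma riemannZeta_one_sub_eq {t : ℂ} (h0 : 0 < t.re) (h1 : t ≠ 1) :
    riemannZeta (1 - t) = zetaFactor t * cos (Real.pi * t / 2) := by
  rw [riemannZeta_one_sub _ h1, zetaFactor]
  · ring
  · rintro n rfl
    simp at h0
    linarith [(Nat.cast_nonneg n : (0 : ℝ) ≤ n)]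

lemma zetaFactor_ne_zero {t : ℂ} (h : 1 ≤ t.re) : zetaFactor t ≠ 0 := by
  have h1 : Gamma t ≠ 0 := Gamma_ne_zero_of_re_pos (by linarith)
  have h2 : (2 * Real.pi : ℂ) ^ (-t) ≠ 0 := by
    rw [Ne, cpow_eq_zero_iff]
    simp [Real.pi_ne_zero]
  have h3 := riemannZeta_ne_zero_of_one_le_re h
  exact mul_ne_zero (mul_ne_zero (mul_ne_zero two_ne_zero h2) h1) h3

lemma exists_norm_inv_zetaFactor_le (B : ℝ) :
    ∃ M : ℝ, 0 < M ∧ ∀ t : ℂ, 2 ≤ t.re → |t.im| ≤ t.re + B →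
      ‖(zetaFactor t)⁻¹‖ ≤ M * Real.exp (-t.re) := by
  obtain ⟨M, hM, h⟩ := exists_two_pi_rpow_mul_norm_inv_Gamma_le B
  refine ⟨3 * M, by positivity, fun t ht him => ?_⟩
  have h1 := h t (by linarith) him
  have h2 := norm_inv_riemannZeta_le ht
  have h3 : ‖((2 * Real.pi : ℂ) ^ (-t))⁻¹‖ = (2 * Real.pi) ^ t.re := by
    rw [cpow_neg, inv_inv]
    have := norm_cpow_eq_rpow_re_of_pos (x := 2 * Real.pi) (by positivity) t
    simpa using this
  rw [zetaFactor, mul_inv, mul_inv, mul_inv, norm_mul, norm_mul, norm_mul, h3, norm_inv,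
    Complex.norm_two]
  calc (2 : ℝ)⁻¹ * (2 * Real.pi) ^ t.re * ‖(Gamma t)⁻¹‖ * ‖(riemannZeta t)⁻¹‖
      = (2 : ℝ)⁻¹ * ((2 * Real.pi) ^ t.re * ‖(Gamma t)⁻¹‖) * ‖(riemannZeta t)⁻¹‖ := by ring
    _ ≤ 1 * (M * Real.exp (-t.re)) * 3 := by gcongr; norm_num
    _ = _ := by ring

/-- Neither Γ nor ζ vanishes at `1 - s`, whose real part is at least 1, so a zero can only come from
the cosine in the functional equation. -/
lemma eq_neg_two_mul_of_riemannZeta_eq_zero {s : ℂ} (hs : s.re ≤ 0) (h : riemannZeta s = 0) :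
    ∃ n : ℕ, 1 ≤ n ∧ s = -2 * n := by
  have hs0 : s ≠ 0 := by
    rintro rfl
    rw [riemannZeta_zero] at h
    norm_num at h
  have hre : 1 ≤ (1 - s).re := by simp; linarith
  have h1 := riemannZeta_one_sub_eq (t := 1 - s) (by linarith) (by simpa using hs0)
  rw [sub_sub_cancel, h] at h1
  have hc := (mul_eq_zero.mp h1.symm).resolve_left (zetaFactor_ne_zero hre)
  obtain ⟨k, hk⟩ := cos_eq_zero_iff.mp hc
  have hpi : (Real.pi : ℂ) ≠ 0 := ofReal_ne_zero.mpr Real.pi_ne_zero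
  have hsk : s = -2 * (k : ℂ) := by
    have : 1 - s = 2 * k + 1 := mul_left_cancel₀ hpi (by linear_combination 2 * hk)
    linear_combination -this
  have hk0 : 0 ≤ k := by
    have : (-2 * (k : ℂ)).re ≤ 0 := hsk ▸ hs
    simp at this
    exact this
  lift k to ℕ using hk0
  refine ⟨k, Nat.one_le_iff_ne_zero.mpr ?_, by simpa using hsk⟩
  rintro rfl
  exact hs0 (by simpa using hsk)

/-- In the derivative of the functional equation at `t = 2n + 1` only the term with the
differentiated cosine survives. Hence the trivial zeros are simple and `1/ζ'(-2n)` inherits the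
decay of `1/A`. -/
lemma deriv_riemannZeta_neg_two_mul (n : ℕ) (hn : 1 ≤ n) :
    deriv riemannZeta (-2 * n) =
      zetaFactor (2 * n + 1) * (Real.pi / 2) * (-1) ^ n := by
  set t : ℂ := 2 * n + 1 with ht
  have hn' : (1 : ℝ) ≤ n := by exact_mod_cast hn
  have htre : t.re = 2 * n + 1 := by simp [ht]
  have ht1 : t ≠ 1 := fun h => by rw [h] at htre; simp at htre; linarith
  have ht0 : (1 : ℂ) - t ≠ 1 := fun h => by
    have : t = 0 := by linear_combination -h
    rw [this] at htre; simp at htre; linarith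
  have hev : (fun x => riemannZeta (1 - x)) =ᶠ[𝓝 t]
      fun x => zetaFactor x * cos (Real.pi * x / 2) := by
    have h1 : ∀ᶠ x : ℂ in 𝓝 t, 0 < x.re :=
      continuous_re.continuousAt.eventually_const_lt (by rw [htre]; linarith)
    filter_upwards [h1, isOpen_ne.mem_nhds ht1] with x hx hx1
    exact riemannZeta_one_sub_eq hx hx1
  have hl : HasDerivAt (fun x => riemannZeta (1 - x)) (deriv riemannZeta (1 - t) * (-1)) t := by
    have h1 : HasDerivAt (fun x : ℂ => 1 - x) (-1) t := by
      simpa using (hasDerivAt_id t).const_sub 1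
    exact (differentiableAt_riemannZeta ht0).hasDerivAt.comp t h1
  have hA : DifferentiableAt ℂ zetaFactor t := by
    have h1 : DifferentiableAt ℂ Gamma t := by
      refine differentiableAt_Gamma t fun m h => ?_
      rw [h] at htre; simp at htre
      linarith [(Nat.cast_nonneg m : (0 : ℝ) ≤ m)]
    have h2 : (2 * Real.pi : ℂ) ≠ 0 := by simp [Real.pi_ne_zero]
    exact (((differentiableAt_const _).mul (differentiableAt_id.neg.const_cpow (Or.inl h2))).mul
      h1).mul (differentiableAt_riemannZeta ht1)
  have hC : HasDerivAt (fun x : ℂ => cos (Real.pi * x / 2))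
      (-sin (Real.pi * t / 2) * (Real.pi / 2)) t := by
    have h1 : HasDerivAt (fun x : ℂ => (Real.pi : ℂ) * x / 2) (Real.pi / 2) t := by
      simpa using ((hasDerivAt_id t).const_mul (Real.pi : ℂ)).div_const 2
    exact h1.ccos
  have harg : (Real.pi : ℂ) * t / 2 = Real.pi / 2 + n * Real.pi := by rw [ht]; ring
  have hcos : cos (Real.pi * t / 2) = 0 := by
    rw [cos_eq_zero_iff]
    exact ⟨n, by rw [ht]; push_cast; ring⟩
  have hsin : sin (Real.pi * t / 2) = (-1) ^ n := by
    rw [harg, add_comm, Complex.sin_add_pi_div_two]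
    exact_mod_cast congrArg ofReal (Real.cos_nat_mul_pi n)
  have hr := (hA.hasDerivAt.mul hC).congr_of_eventuallyEq hev
  have := hl.unique hr
  rw [hcos, hsin] at this
  have h1t : (1 : ℂ) - t = -2 * n := by rw [ht]; ring
  rw [h1t] at this
  linear_combination -this

lemma deriv_riemannZeta_neg_two_mul_ne_zero {n : ℕ} (hn : 1 ≤ n) :
    deriv riemannZeta (-2 * n) ≠ 0 := by
  rw [deriv_riemannZeta_neg_two_mul n hn]
  have h1 : zetaFactor (2 * n + 1) ≠ 0 := by
    refine zetaFactor_ne_zero ?_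
    simp
  have hpi : (Real.pi : ℂ) ≠ 0 := ofReal_ne_zero.mpr Real.pi_ne_zero
  exact mul_ne_zero (mul_ne_zero h1 (div_ne_zero hpi two_ne_zero)) (pow_ne_zero _ (by norm_num))

lemma exists_norm_inv_deriv_riemannZeta_le :
    ∃ M : ℝ, 0 < M ∧ ∀ n : ℕ, 1 ≤ n →
      ‖(deriv riemannZeta (-2 * n))⁻¹‖ ≤ M * Real.exp (-n) := by
  obtain ⟨M, hM, h⟩ := exists_norm_inv_zetaFactor_le 0
  refine ⟨M, hM, fun n hn => ?_⟩
  have hn' : (1 : ℝ) ≤ n := by exact_mod_cast hn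
  have h1 := h (2 * n + 1) (by simp; linarith) (by simp; linarith)
  have h2 : ‖((Real.pi : ℂ) / 2)⁻¹‖ ≤ 1 := by
    rw [norm_inv, norm_div, norm_real, Complex.norm_two, Real.norm_eq_abs,
      abs_of_pos Real.pi_pos]
    exact inv_le_one_of_one_le₀ (by linarith [Real.pi_gt_three])
  rw [deriv_riemannZeta_neg_two_mul n hn, mul_inv, mul_inv, norm_mul, norm_mul]
  have h3 : ‖(((-1 : ℂ)) ^ n)⁻¹‖ = 1 := by simp
  rw [h3, mul_one]
  calc _ ≤ M * Real.exp (-(2 * n + 1 : ℂ).re) * 1 := by gcongr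
    _ ≤ M * Real.exp (-n) := by
      rw [mul_one]
      gcongr
      simp; linarith

lemma riemannZeta_neg_two_mul_eq_zero {n : ℕ} (hn : 1 ≤ n) : riemannZeta (-2 * n) = 0 := by
  obtain ⟨k, rfl⟩ := Nat.exists_eq_add_of_le' hn
  simpa using riemannZeta_neg_two_mul_nat_add_one k

/-! ### The odd kernel, its poles in the strip and their residues. -/

/-- The kernel in the variable `z = v + i / 2`, in which it is odd. -/
noncomputable def stripKernel (a w : ℝ) (z : ℂ) : ℂ :=
  I * (w : ℂ) ^ (z ^ 2 + 1 / 4) / (riemannZeta (a * (4 * z ^ 2 + 1)) * sinh (Real.pi * z))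

lemma zetaKernel_eq_stripKernel (a w v : ℝ) :
    zetaKernel a w v = stripKernel a w (v + ((1 / 2 : ℝ) : ℂ) * I) := by
  have h1 : ((v : ℂ) + ((1 / 2 : ℝ) : ℂ) * I) ^ 2 + 1 / 4 = (v : ℂ) ^ 2 + I * v := by
    push_cast; linear_combination (1 / 4 : ℂ) * I_sq
  have h2 : (a : ℂ) * (4 * ((v : ℂ) + ((1 / 2 : ℝ) : ℂ) * I) ^ 2 + 1) = 4 * a * v * (v + I) := by
    linear_combination (4 * a : ℂ) * h1
  have h3 : sinh (Real.pi * ((v : ℂ) + ((1 / 2 : ℝ) : ℂ) * I)) = I * cosh (Real.pi * v) := by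
    have e : (Real.pi : ℂ) * ((v : ℂ) + ((1 / 2 : ℝ) : ℂ) * I) =
        Real.pi * v + (Real.pi / 2) * I := by push_cast; ring
    rw [e, Complex.sinh_add, Complex.cosh_mul_I, Complex.sinh_mul_I, Complex.cos_pi_div_two,
      Complex.sin_pi_div_two]
    ring
  unfold zetaKernel stripKernel
  rw [h1, h2, h3, show ∀ x y : ℂ, x * (I * y) = I * (x * y) from fun x y => by ring,
    mul_div_mul_left _ _ I_ne_zero]

lemma stripKernel_neg (a w : ℝ) (z : ℂ) : stripKernel a w (-z) = -stripKernel a w z := by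
  simp only [stripKernel, neg_sq, mul_neg, Complex.sinh_neg, div_neg]

/-- A square root of `(-2n / a - 1) / 4`, so that `a (4 z² + 1) = -2n` there. -/
noncomputable def zetaPole (a : ℝ) (n : ℕ) : ℂ :=
  if 0 ≤ -a ^ 2 - 2 * a * n then ((√(-a ^ 2 - 2 * a * n) / (2 * a) : ℝ) : ℂ)
  else I * ((√(a ^ 2 + 2 * a * n) / (2 * a) : ℝ) : ℂ)

lemma zetaPole_sq {a : ℝ} (n : ℕ) :
    zetaPole a n ^ 2 = (((-a ^ 2 - 2 * a * n) / (4 * a ^ 2) : ℝ) : ℂ) := by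
  unfold zetaPole
  split_ifs with h
  · rw [← ofReal_pow, div_pow, Real.sq_sqrt h]
    congr 1; ring
  · rw [mul_pow, I_sq, ← ofReal_pow, div_pow, Real.sq_sqrt (by linarith)]
    push_cast; ring

lemma mul_four_zetaPole_sq_add_one {a : ℝ} (ha : a < 0) (n : ℕ) :
    (a : ℂ) * (4 * zetaPole a n ^ 2 + 1) = -2 * n := by
  have ha' : (a : ℂ) ≠ 0 := ofReal_ne_zero.mpr ha.ne
  rw [zetaPole_sq]
  push_cast
  field_simp
  ring

lemma zetaPole_ne_zero {a : ℝ} (ha : a < 0) {n : ℕ} (h : (2 * n : ℝ) ≠ -a) :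
    zetaPole a n ≠ 0 := by
  intro h0
  have h1 := mul_four_zetaPole_sq_add_one ha n
  rw [h0] at h1
  have h2 : a = -2 * n := by
    have : (a : ℂ) = ((-2 * n : ℝ) : ℂ) := by push_cast; linear_combination h1
    exact_mod_cast this
  exact h (by linarith)

lemma zetaPole_sq_injective {a : ℝ} (ha : a < 0) {n m : ℕ}
    (h : zetaPole a n ^ 2 = zetaPole a m ^ 2) : n = m := by
  have h1 := mul_four_zetaPole_sq_add_one ha n
  rw [h, mul_four_zetaPole_sq_add_one ha m] at h1
  have : (m : ℂ) = n := by linear_combination (-1 / 2 : ℂ) * h1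
  exact_mod_cast this.symm

/-- `hk` says that `a(4R² + 1) = 1 - 2k`, an odd integer midway between the trivial zeros `-2k` and
`-2(k - 1)`, so the poles of index below `k` lie strictly inside the rectangle. -/
lemma zetaPole_mem {a R : ℝ} (ha : a < 0) (hR : 0 < R) {k n : ℕ}
    (hk : -a * (4 * R ^ 2 + 1) + 1 = 2 * k) (hn1 : 1 ≤ n) (hnk : n < k) :
    |(zetaPole a n).re| < R ∧ |(zetaPole a n).im| < 1 / 2 := by
  have hn1' : (1 : ℝ) ≤ n := by exact_mod_cast hn1
  have hnk' : (n : ℝ) + 1 ≤ k := by exact_mod_cast hnk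
  have hsq := zetaPole_sq (a := a) n
  have ha2 : 0 < 4 * a ^ 2 := by have := sq_pos_of_neg ha; positivity
  unfold zetaPole at hsq ⊢
  split_ifs at hsq ⊢ with h
  · have h1 : (√(-a ^ 2 - 2 * a * n) / (2 * a)) ^ 2 = (-a ^ 2 - 2 * a * n) / (4 * a ^ 2) := by
      exact_mod_cast hsq
    refine ⟨?_, by simp [-ofReal_div]⟩
    rw [ofReal_re]
    refine abs_lt_of_sq_lt_sq ?_ hR.le
    rw [h1, div_lt_iff₀ ha2]
    nlinarith
  · have h1 : (√(a ^ 2 + 2 * a * n) / (2 * a)) ^ 2 = (a ^ 2 + 2 * a * n) / (4 * a ^ 2) := by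
      rw [div_pow, Real.sq_sqrt (by linarith)]; ring
    refine ⟨by simpa [-ofReal_div] using hR, ?_⟩
    rw [I_mul_im, ofReal_re]
    refine abs_lt_of_sq_lt_sq ?_ (by norm_num)
    rw [h1, div_lt_iff₀ ha2]
    nlinarith

lemma re_mul_four_sq_add_one (a : ℝ) (z : ℂ) :
    ((a : ℂ) * (4 * z ^ 2 + 1)).re = a * (4 * (z.re ^ 2 - z.im ^ 2) + 1) := by
  have : (z ^ 2).re = z.re ^ 2 - z.im ^ 2 := by rw [sq, mul_re]; ring
  rw [re_ofReal_mul, add_re, one_re, show (4 : ℂ) * z ^ 2 = ((4 : ℝ) : ℂ) * z ^ 2 by norm_num,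
    re_ofReal_mul, this]

lemma re_mul_four_sq_add_one_nonpos {a : ℝ} (ha : a < 0) {z : ℂ} (hz : |z.im| ≤ 1 / 2) :
    ((a : ℂ) * (4 * z ^ 2 + 1)).re ≤ 0 := by
  rw [re_mul_four_sq_add_one]
  have h1 : z.im ^ 2 ≤ (1 / 2) ^ 2 := sq_le_sq' (by linarith [(abs_le.mp hz).1]) (abs_le.mp hz).2
  have h2 := sq_nonneg z.re
  exact mul_nonpos_of_nonpos_of_nonneg ha.le (by nlinarith)

lemma sinh_pi_mul_ne_zero {z : ℂ} (hz : |z.im| ≤ 1 / 2) (h0 : z ≠ 0) :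
    sinh (Real.pi * z) ≠ 0 := by
  intro h
  have hpi : (Real.pi : ℂ) ≠ 0 := ofReal_ne_zero.mpr Real.pi_ne_zero
  have h1 : sin (Real.pi * z * I) = 0 := by rw [Complex.sin_mul_I, h, zero_mul]
  obtain ⟨k, hk⟩ := Complex.sin_eq_zero_iff.mp h1
  have h2 : z * I = k := mul_left_cancel₀ hpi (by linear_combination hk)
  have hre : -z.im = k := by simpa using congrArg re h2
  have him : z.re = 0 := by simpa using congrArg im h2
  have hk0 : k = 0 := by
    have h3 : |(k : ℝ)| ≤ 1 / 2 := by rw [← hre, abs_neg]; exact hz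
    have h4 : |(k : ℝ)| < 1 := by linarith
    exact Int.abs_lt_one_iff.mp (by exact_mod_cast h4)
  refine h0 (Complex.ext him ?_)
  rw [hk0] at hre
  simpa using hre

lemma exists_eq_zetaPole {a : ℝ} (ha : a < 0) {z : ℂ} (hz : |z.im| ≤ 1 / 2)
    (h : riemannZeta (a * (4 * z ^ 2 + 1)) = 0) :
    ∃ n : ℕ, 1 ≤ n ∧ (a : ℂ) * (4 * z ^ 2 + 1) = -2 * n ∧ (z = zetaPole a n ∨ z = -zetaPole a n) := by
  obtain ⟨n, hn, hs⟩ := eq_neg_two_mul_of_riemannZeta_eq_zero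
    (re_mul_four_sq_add_one_nonpos ha hz) h
  refine ⟨n, hn, hs, sq_eq_sq_iff_eq_or_eq_neg.mp ?_⟩
  have ha' : (a : ℂ) ≠ 0 := ofReal_ne_zero.mpr ha.ne
  have h1 := hs.trans (mul_four_zetaPole_sq_add_one ha n).symm
  have h2 := mul_left_cancel₀ ha' h1
  linear_combination (1 / 4 : ℂ) * h2

lemma differentiableAt_numerator {w : ℝ} (hw : 0 < w) (z : ℂ) :
    DifferentiableAt ℂ (fun z : ℂ => I * (w : ℂ) ^ (z ^ 2 + 1 / 4)) z := by
  have hw' : (w : ℂ) ≠ 0 := ofReal_ne_zero.mpr hw.ne'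
  exact (DifferentiableAt.const_cpow (by fun_prop) (Or.inl hw')).const_mul _

lemma mul_four_sq_add_one_ne_one {a : ℝ} (ha : a < 0) {z : ℂ} (hz : |z.im| ≤ 1 / 2) :
    (a : ℂ) * (4 * z ^ 2 + 1) ≠ 1 := by
  intro h
  have := re_mul_four_sq_add_one_nonpos ha hz
  rw [h] at this
  norm_num at this

lemma hasDerivAt_zeta_comp {a : ℝ} (ha : a < 0) {z : ℂ} (hz : |z.im| ≤ 1 / 2) :
    HasDerivAt (fun z : ℂ => riemannZeta (a * (4 * z ^ 2 + 1)))
      (deriv riemannZeta (a * (4 * z ^ 2 + 1)) * (8 * a * z)) z := by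
  have h1 : HasDerivAt (fun z : ℂ => (a : ℂ) * (4 * z ^ 2 + 1)) (8 * a * z) z := by
    have := (((hasDerivAt_pow 2 z).const_mul 4).add_const 1).const_mul (a : ℂ)
    refine this.congr_deriv ?_
    push_cast; ring
  exact (differentiableAt_riemannZeta (mul_four_sq_add_one_ne_one ha hz)).hasDerivAt.comp z h1

lemma hasDerivAt_sinh_pi_mul (z : ℂ) :
    HasDerivAt (fun z : ℂ => sinh (Real.pi * z)) (cosh (Real.pi * z) * Real.pi) z := by
  have h1 : HasDerivAt (fun z : ℂ => (Real.pi : ℂ) * z) Real.pi z := by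
    simpa using (hasDerivAt_id z).const_mul (Real.pi : ℂ)
  exact h1.csinh

lemma differentiableAt_stripKernel {a w : ℝ} (ha : a < 0) (hw : 0 < w) {z : ℂ}
    (hz : |z.im| ≤ 1 / 2) (h0 : z ≠ 0) (hζ : riemannZeta (a * (4 * z ^ 2 + 1)) ≠ 0) :
    DifferentiableAt ℂ (stripKernel a w) z :=
  (differentiableAt_numerator hw z).div
    ((hasDerivAt_zeta_comp ha hz).differentiableAt.mul (hasDerivAt_sinh_pi_mul z).differentiableAt)
    (mul_ne_zero hζ (sinh_pi_mul_ne_zero hz h0))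

lemma tendsto_sub_mul_div {N g : ℂ → ℂ} {p g' : ℂ} (hN : ContinuousAt N p)
    (hg : HasDerivAt g g' p) (h0 : g p = 0) (hg' : g' ≠ 0) :
    Tendsto (fun z => (z - p) * (N z / g z)) (𝓝[≠] p) (𝓝 (N p / g')) := by
  have h1 := hasDerivAt_iff_tendsto_slope.mp hg
  refine ((hN.tendsto.mono_left nhdsWithin_le_nhds).div h1 hg').congr' ?_
  filter_upwards [self_mem_nhdsWithin] with z hz
  have : z - p ≠ 0 := sub_ne_zero.mpr hz
  change N z / slope g p z = _
  rw [slope_def_field, h0, sub_zero, div_div_eq_mul_div]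
  ring

/-- The residue of `stripKernel` at the zeros of `ζ (a (4 z² + 1))`. -/
noncomputable def kernelResidue (a w : ℝ) (z : ℂ) : ℂ :=
  I * (w : ℂ) ^ (z ^ 2 + 1 / 4) /
    (deriv riemannZeta (a * (4 * z ^ 2 + 1)) * (8 * a * z) * sinh (Real.pi * z))

lemma kernelResidue_neg (a w : ℝ) (z : ℂ) : kernelResidue a w (-z) = kernelResidue a w z := by
  simp only [kernelResidue, neg_sq, mul_neg, Complex.sinh_neg, neg_mul, neg_neg]

lemma tendsto_stripKernel_residue {a w : ℝ} (ha : a < 0) (hw : 0 < w) {p : ℂ} {n : ℕ} (hn : 1 ≤ n)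
    (hp : |p.im| ≤ 1 / 2) (hp0 : p ≠ 0) (h : (a : ℂ) * (4 * p ^ 2 + 1) = -2 * n) :
    Tendsto (fun z => (z - p) * stripKernel a w z) (𝓝[≠] p) (𝓝 (kernelResidue a w p)) := by
  have ha' : (a : ℂ) ≠ 0 := ofReal_ne_zero.mpr ha.ne
  have hs := sinh_pi_mul_ne_zero hp hp0
  have hN : ContinuousAt (fun z : ℂ => I * (w : ℂ) ^ (z ^ 2 + 1 / 4) / sinh (Real.pi * z)) p :=
    ((differentiableAt_numerator hw p).div (hasDerivAt_sinh_pi_mul p).differentiableAt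
      hs).continuousAt
  have hd : deriv riemannZeta (a * (4 * p ^ 2 + 1)) ≠ 0 := by
    rw [h]; exact deriv_riemannZeta_neg_two_mul_ne_zero hn
  have := tendsto_sub_mul_div hN (hasDerivAt_zeta_comp ha hp)
    (by rw [h]; exact riemannZeta_neg_two_mul_eq_zero hn)
    (mul_ne_zero hd (mul_ne_zero (mul_ne_zero (by norm_num) ha') hp0))
  convert this using 2
  · rw [stripKernel, div_div, mul_comm (sinh _)]
  · rw [kernelResidue, div_div, mul_comm (sinh _)]

/-- The indices of the poles of `stripKernel a w`, other than `0`, below `k`. -/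
noncomputable def poleIndices (a : ℝ) (k : ℕ) : Finset ℕ :=
  open Classical in (Finset.range k).filter fun n => 1 ≤ n ∧ (2 * n : ℝ) ≠ -a

lemma mem_poleIndices {a : ℝ} {k n : ℕ} :
    n ∈ poleIndices a k ↔ n < k ∧ 1 ≤ n ∧ (2 * n : ℝ) ≠ -a := by
  simp [poleIndices]

/-- The poles of `stripKernel a w` with index below `k`, and `0`. -/
noncomputable def kernelPoles (a : ℝ) (k : ℕ) : Finset ℂ :=
  open Classical in insert 0 ((poleIndices a k).image (zetaPole a) ∪
    (poleIndices a k).image fun n => -zetaPole a n)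

lemma mem_kernelPoles {a : ℝ} {k : ℕ} {z : ℂ} :
    z ∈ kernelPoles a k ↔
      z = 0 ∨ ∃ n ∈ poleIndices a k, z = zetaPole a n ∨ z = -zetaPole a n := by
  simp only [kernelPoles, Finset.mem_insert, Finset.mem_union, Finset.mem_image]
  grind

lemma sum_kernelPoles {a : ℝ} (ha : a < 0) (k : ℕ) (f : ℂ → ℂ) (hf : ∀ z, f (-z) = f z) :
    ∑ z ∈ kernelPoles a k, f z = f 0 + 2 * ∑ n ∈ poleIndices a k, f (zetaPole a n) := by
  classical
  have hne : ∀ n ∈ poleIndices a k, zetaPole a n ≠ 0 := fun n hn =>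
    zetaPole_ne_zero ha (mem_poleIndices.mp hn).2.2
  have hinj : ∀ n m, zetaPole a n = zetaPole a m → n = m := fun n m h =>
    zetaPole_sq_injective ha (by rw [h])
  have hk : kernelPoles a k = insert 0 ((poleIndices a k).image (zetaPole a) ∪
    (poleIndices a k).image fun n => -zetaPole a n) := by
    ext z; simp [kernelPoles]
  rw [hk, Finset.sum_insert, Finset.sum_union, Finset.sum_image, Finset.sum_image]
  · simp only [hf]; ring
  · intro n _ m _ h
    exact hinj n m (neg_injective h)
  · intro n _ m _ h
    exact hinj n m h
  · rw [Finset.disjoint_left]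
    intro z h1 h2
    obtain ⟨n, hn, rfl⟩ := Finset.mem_image.mp h1
    obtain ⟨m, hm, h⟩ := Finset.mem_image.mp h2
    have hmn : m = n := zetaPole_sq_injective ha (by rw [← h, neg_sq])
    subst hmn
    exact hne m hn (self_eq_neg.mp h.symm)
  · simp only [Finset.mem_union, Finset.mem_image, not_or, not_exists, not_and]
    exact ⟨fun n hn h => hne n hn h, fun n hn h => hne n hn (neg_eq_zero.mp h)⟩

/-! ### The contour integral of the kernel. -/

/-- Since `s⁻³` has a single-valued primitive, the leading part of a triple pole can be removed at
no cost. -/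
lemma rectIntegral_inv_cube {z w : ℂ} (h0 : (0 : ℂ) ∈ Ioo z.re w.re ×ℂ Ioo z.im w.im) :
    rectIntegral (fun s => (s ^ 3)⁻¹) z w = 0 := by
  have hne : ∀ s ∈ rectFrame z w, s ≠ 0 := by
    rintro s hs rfl
    exact notMem_rectFrame h0 hs
  refine rectIntegral_eq_zero_of_primitive (g := fun s => (-1 / 2) * (s ^ 2)⁻¹)
    (fun s hs => ?_) ?_
  · have h1 := ((hasDerivAt_pow 2 s).inv (pow_ne_zero 2 (hne s hs))).const_mul (-1 / 2 : ℂ)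
    refine h1.congr_deriv ?_
    have := hne s hs
    push_cast
    field_simp
  · exact ContinuousOn.inv₀ (by fun_prop) fun s hs => pow_ne_zero 3 (hne s hs)

lemma differentiableAt_stripKernel_of_notMem {a w R : ℝ} (ha : a < 0) (hw : 0 < w) {k : ℕ}
    (hk : -a * (4 * R ^ 2 + 1) + 1 = 2 * k) {s : ℂ} (h1 : |s.re| ≤ R) (h2 : |s.im| ≤ 1 / 2)
    (hsS : s ∉ kernelPoles a k) : DifferentiableAt ℂ (stripKernel a w) s := by
  have hs0 : s ≠ 0 := fun h => hsS (mem_kernelPoles.mpr (Or.inl h))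
  refine differentiableAt_stripKernel ha hw h2 hs0 fun hζ => hsS ?_
  obtain ⟨n, hn1, hn, hsn⟩ := exists_eq_zetaPole ha h2 hζ
  refine mem_kernelPoles.mpr (Or.inr ⟨n, mem_poleIndices.mpr ⟨?_, hn1, fun h => hs0 ?_⟩, hsn⟩)
  · have h3 := congrArg re hn
    rw [re_mul_four_sq_add_one] at h3
    simp only [neg_mul, neg_re, mul_re, re_ofNat, natCast_re, im_ofNat, natCast_im, mul_zero,
      sub_zero] at h3
    have h4 : s.re ^ 2 ≤ R ^ 2 := sq_le_sq' (abs_le.mp h1).1 (abs_le.mp h1).2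
    have h5 : (n : ℝ) < k := by nlinarith [sq_nonneg s.im]
    exact_mod_cast h5
  · have ha' : (a : ℂ) ≠ 0 := ofReal_ne_zero.mpr ha.ne
    have h3 : (2 * n : ℂ) = -a := by exact_mod_cast congrArg ofReal h
    have h4 : (a : ℂ) * s ^ 2 = a * 0 := by linear_combination (1 / 4 : ℂ) * hn - 1 / 4 * h3
    exact pow_eq_zero_iff two_ne_zero |>.mp (mul_left_cancel₀ ha' h4)

lemma bounds_of_mem_kernelPoles {a R : ℝ} (ha : a < 0) (hR : 0 < R) {k : ℕ}
    (hk : -a * (4 * R ^ 2 + 1) + 1 = 2 * k) {z : ℂ} (hz : z ∈ kernelPoles a k) (hz0 : z ≠ 0) :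
    |z.re| < R ∧ |z.im| < 1 / 2 ∧ ∃ n : ℕ, 1 ≤ n ∧ (a : ℂ) * (4 * z ^ 2 + 1) = -2 * n := by
  rcases mem_kernelPoles.mp hz with h | ⟨n, hn, h⟩
  · exact absurd h hz0
  · obtain ⟨hnk, hn1, -⟩ := mem_poleIndices.mp hn
    obtain ⟨h1, h2⟩ := zetaPole_mem ha hR hk hn1 hnk
    have h3 := mul_four_zetaPole_sq_add_one ha n
    rcases h with rfl | rfl
    · exact ⟨h1, h2, n, hn1, h3⟩
    · exact ⟨by simpa using h1, by simpa using h2, n, hn1, by rwa [neg_sq]⟩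

/-- An odd kernel has no `z⁻²` term at 0, so one hypothesis serves both cases: `c₃ = 0` for a simple
pole there, `c₃ ≠ 0` for a triple one. -/
theorem rectIntegral_stripKernel {a w R : ℝ} (ha : a < 0) (hw : 0 < w) (hR : 0 < R) {k : ℕ}
    (hk : -a * (4 * R ^ 2 + 1) + 1 = 2 * k) {c₀ c₃ : ℂ}
    (hlim : Tendsto (fun z => z * (stripKernel a w z - c₃ * (z ^ 3)⁻¹)) (𝓝[≠] 0) (𝓝 c₀)) :
    rectIntegral (stripKernel a w) ⟨-R, -(1 / 2)⟩ ⟨R, 1 / 2⟩ =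
      2 * Real.pi * I *
        (c₀ + 2 * ∑ n ∈ poleIndices a k, kernelResidue a w (zetaPole a n)) := by
  classical
  set A : ℂ := ⟨-R, -(1 / 2)⟩ with hA
  set B : ℂ := ⟨R, 1 / 2⟩ with hB
  have hopen : ∀ z : ℂ, |z.re| < R → |z.im| < 1 / 2 → z ∈ Ioo A.re B.re ×ℂ Ioo A.im B.im :=
    fun z h1 h2 => by
      rw [mem_reProdIm]
      exact ⟨abs_lt.mp h1, abs_lt.mp h2⟩
  have h0mem : (0 : ℂ) ∈ Ioo A.re B.re ×ℂ Ioo A.im B.im := hopen 0 (by simpa) (by simp)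
  have hclosed : ∀ z ∈ [[A.re, B.re]] ×ℂ [[A.im, B.im]], |z.re| ≤ R ∧ |z.im| ≤ 1 / 2 := by
    rintro z ⟨h1, h2⟩
    have hm1 : z.re ∈ [[-R, R]] := h1
    have hm2 : z.im ∈ [[(-(1 / 2) : ℝ), 1 / 2]] := h2
    rw [uIcc_of_le (by linarith)] at hm1
    rw [uIcc_of_le (by norm_num)] at hm2
    exact ⟨abs_le.mpr hm1, abs_le.mpr hm2⟩
  have hpole := fun z (hz : z ∈ kernelPoles a k) hz0 => bounds_of_mem_kernelPoles ha hR hk hz hz0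
  obtain ⟨f, hf⟩ : ∃ f : ℂ → ℂ, f = fun z => stripKernel a w z - c₃ * (z ^ 3)⁻¹ := ⟨_, rfl⟩
  obtain ⟨res, hres⟩ : ∃ res : ℂ → ℂ, res = fun z => if z = 0 then c₀ else kernelResidue a w z :=
    ⟨_, rfl⟩
  have hFd : ∀ s ∈ [[A.re, B.re]] ×ℂ [[A.im, B.im]], s ∉ kernelPoles a k →
      DifferentiableAt ℂ (stripKernel a w) s := by
    intro s hs hsS
    obtain ⟨h1, h2⟩ := hclosed s hs
    exact differentiableAt_stripKernel_of_notMem ha hw hk h1 h2 hsS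
  have hcube : ∀ s : ℂ, s ≠ 0 → DifferentiableAt ℂ (fun z : ℂ => c₃ * (z ^ 3)⁻¹) s :=
    fun s hs => by
      have := pow_ne_zero 3 hs
      fun_prop (disch := assumption)
  have hmain : rectIntegral f A B = 2 * Real.pi * I * ∑ p ∈ kernelPoles a k, res p := by
    refine rectIntegral_eq_sum_residues (kernelPoles a k) res (fun p hp => ?_) (fun s hs hsS => ?_) fun p hp => ?_
    · rcases eq_or_ne p 0 with rfl | hp0
      · exact h0mem
      · obtain ⟨h1, h2, -⟩ := hpole p hp hp0
        exact hopen p h1 h2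
    · have hs0 : s ≠ 0 := fun h => hsS (mem_kernelPoles.mpr (Or.inl h))
      rw [hf]
      exact (hFd s hs hsS).sub (hcube s hs0)
    · rcases eq_or_ne p 0 with rfl | hp0
      · simpa [hres, hf] using hlim
      · obtain ⟨h1, h2, n, hn1, hn⟩ := hpole p hp hp0
        have h3 := tendsto_stripKernel_residue ha hw hn1 h2.le hp0 hn
        have h4 : Tendsto (fun z => (z - p) * (c₃ * (z ^ 3)⁻¹)) (𝓝[≠] p) (𝓝 0) := by
          have h5 : ContinuousAt (fun z => (z - p) * (c₃ * (z ^ 3)⁻¹)) p :=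
            (continuousAt_id.sub continuousAt_const).mul (hcube p hp0).continuousAt
          simpa using h5.tendsto.mono_left nhdsWithin_le_nhds
        have h6 := h3.sub h4
        simp only [hres, hp0, if_false, hf]
        rw [sub_zero] at h6
        exact h6.congr fun z => by ring
  have hfne : ∀ s ∈ rectFrame A B, s ≠ 0 := by
    rintro s hs rfl
    exact notMem_rectFrame h0mem hs
  have hfc : ContinuousOn f (rectFrame A B) := fun s hs => by
    have hsS : s ∉ kernelPoles a k := by
      intro h
      obtain ⟨h1, h2, -⟩ := hpole s h (hfne s hs)
      exact notMem_rectFrame (hopen s h1 h2) hs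
    rw [hf]
    exact ((hFd s (rectFrame_subset _ _ hs) hsS).sub
      (hcube s (hfne s hs))).continuousAt.continuousWithinAt
  have hcc : ContinuousOn (fun z : ℂ => c₃ * (z ^ 3)⁻¹) (rectFrame A B) := fun s hs =>
    (hcube s (hfne s hs)).continuousAt.continuousWithinAt
  have hadd : rectIntegral (stripKernel a w) A B = rectIntegral f A B := by
    rw [show stripKernel a w = fun z => f z + c₃ * (z ^ 3)⁻¹ from funext fun z => by simp [hf],
      rectIntegral_add hfc hcc, rectIntegral_const_mul, rectIntegral_inv_cube h0mem, mul_zero,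
      add_zero]
  have heven : ∀ z, res (-z) = res z := fun z => by
    simp only [hres, neg_eq_zero, kernelResidue_neg]
  rw [hadd, hmain, sum_kernelPoles ha k res heven]
  congr 2
  · simp [hres]
  · congr 1
    refine Finset.sum_congr rfl fun n hn => ?_
    have := zetaPole_ne_zero ha (mem_poleIndices.mp hn).2.2
    simp [hres, this]

/-- The map `z ↦ -z` exchanges opposite edges and the kernel changes sign, so the edges of each pair
contribute equally. -/
lemma rectIntegral_stripKernel_eq_integral (a w R : ℝ) :
    rectIntegral (stripKernel a w) ⟨-R, -(1 / 2)⟩ ⟨R, 1 / 2⟩ =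
      -2 * (∫ v : ℝ in -R..R, zetaKernel a w v) +
        2 * I * ∫ y : ℝ in -(1 / 2)..(1 / 2), stripKernel a w (R + y * I) := by
  have hbot : (∫ x : ℝ in -R..R, stripKernel a w (x + ((-(1 / 2) : ℝ) : ℂ) * I)) =
      -∫ v : ℝ in -R..R, zetaKernel a w v := by
    rw [← intervalIntegral.integral_neg, ← neg_neg R, ← intervalIntegral.integral_comp_neg, neg_neg]
    refine intervalIntegral.integral_congr fun x _ => ?_
    rw [zetaKernel_eq_stripKernel, ← stripKernel_neg]
    congr 1
    push_cast; ring
  have hleft : (∫ y : ℝ in (-(1 / 2))..(1 / 2), stripKernel a w (((-R : ℝ) : ℂ) + y * I)) =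
      -∫ y : ℝ in (-(1 / 2))..(1 / 2), stripKernel a w (R + y * I) := by
    have h := intervalIntegral.integral_comp_neg (a := -(1 / 2)) (b := 1 / 2)
      (fun y : ℝ => stripKernel a w (((-R : ℝ) : ℂ) + y * I))
    rw [neg_neg] at h
    rw [← h, ← intervalIntegral.integral_neg]
    refine intervalIntegral.integral_congr fun y _ => ?_
    rw [← stripKernel_neg]
    congr 1
    push_cast; ring
  unfold rectIntegral
  simp only
  rw [hbot, hleft]
  simp only [← zetaKernel_eq_stripKernel, smul_eq_mul]
  ring

/-! ### Bounds for the kernel on the edges of the rectangle. -/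

lemma abs_sinh_im_le_norm_cos (z : ℂ) : |Real.sinh z.im| ≤ ‖cos z‖ := by
  have h : cos z = (exp (z * I) + exp (-z * I)) / 2 := rfl
  have h1 : ‖exp (z * I)‖ = Real.exp (-z.im) := by rw [norm_exp]; simp
  have h2 : ‖-exp (-z * I)‖ = Real.exp z.im := by rw [norm_neg, norm_exp]; simp
  have h3 := abs_norm_sub_norm_le (exp (z * I)) (-exp (-z * I))
  rw [h1, h2, sub_neg_eq_add] at h3
  rw [h, norm_div, Complex.norm_two, Real.sinh_eq, abs_div, abs_sub_comm, abs_two]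
  gcongr

lemma abs_cos_re_le_norm_cos (z : ℂ) : |Real.cos z.re| ≤ ‖cos z‖ := by
  have h : (cos z).re = Real.cos z.re * Real.cosh z.im := by
    conv_lhs => rw [← re_add_im z, Complex.cos_add, Complex.cos_mul_I, Complex.sin_mul_I]
    simp [← ofReal_cos, ← ofReal_sin, ← ofReal_cosh, ← ofReal_sinh]
  calc |Real.cos z.re| ≤ |Real.cos z.re| * Real.cosh z.im :=
        le_mul_of_one_le_right (abs_nonneg _) (Real.one_le_cosh _)
    _ = |(cos z).re| := by rw [h, abs_mul, abs_of_pos (Real.cosh_pos _)]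
    _ ≤ _ := abs_re_le_norm _

lemma abs_sinh_re_le_norm_sinh (z : ℂ) : |Real.sinh z.re| ≤ ‖sinh z‖ := by
  have h : sinh z = (exp z - exp (-z)) / 2 := rfl
  have h1 : ‖exp z‖ = Real.exp z.re := norm_exp z
  have h2 : ‖exp (-z)‖ = Real.exp (-z.re) := by rw [norm_exp]; simp
  have h3 := abs_norm_sub_norm_le (exp z) (exp (-z))
  rw [h1, h2] at h3
  rw [h, norm_div, Complex.norm_two, Real.sinh_eq, abs_div, abs_two]
  gcongr

lemma abs_le_abs_sinh (x : ℝ) : |x| ≤ |Real.sinh x| := by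
  rcases le_total 0 x with h | h
  · exact (abs_le_abs_of_nonneg h (Real.self_le_sinh_iff.mpr h))
  · rw [abs_of_nonpos h, abs_of_nonpos (Real.sinh_nonpos_iff.mpr h)]
    exact neg_le_neg (Real.sinh_le_self_iff.mpr h)

lemma norm_numerator_le_one {w : ℝ} (hw : 0 < w) (hw1 : w ≤ 1) {z : ℂ} (hz : |z.im| ≤ 1 / 2) :
    ‖I * (w : ℂ) ^ (z ^ 2 + 1 / 4)‖ ≤ 1 := by
  rw [norm_mul, norm_I, one_mul, norm_cpow_eq_rpow_re_of_pos hw]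
  refine Real.rpow_le_one hw.le hw1 ?_
  have h := re_mul_four_sq_add_one 1 z
  have h1 : z.im ^ 2 ≤ (1 / 2) ^ 2 := sq_le_sq' (by linarith [(abs_le.mp hz).1]) (abs_le.mp hz).2
  have h2 : (z ^ 2 + 1 / 4).re = z.re ^ 2 - z.im ^ 2 + 1 / 4 := by
    have : z ^ 2 + 1 / 4 = ((1 / 4 : ℝ) : ℂ) * (((1 : ℝ) : ℂ) * (4 * z ^ 2 + 1)) := by
      push_cast; ring
    rw [this, re_ofReal_mul, h]; ring
  rw [h2]
  nlinarith [sq_nonneg z.re]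

lemma re_im_one_sub (a : ℝ) (z : ℂ) :
    (1 - (a : ℂ) * (4 * z ^ 2 + 1)).re = 1 - a * (4 * (z.re ^ 2 - z.im ^ 2) + 1) ∧
    (1 - (a : ℂ) * (4 * z ^ 2 + 1)).im = -8 * a * z.re * z.im := by
  refine ⟨by rw [sub_re, one_re, re_mul_four_sq_add_one], ?_⟩
  have : (z ^ 2).im = 2 * z.re * z.im := by rw [sq, mul_im]; ring
  rw [sub_im, one_im, im_ofReal_mul, add_im, one_im,
    show (4 : ℂ) * z ^ 2 = ((4 : ℝ) : ℂ) * z ^ 2 by norm_num, im_ofReal_mul, this]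
  ring

/-- For `t = 1 - a(4z² + 1)` and `z = x + iy`, `|Im t| = 8|a||x||y| ≤ 4|a||x| ≤ 4|a|x² + |a|`, which
places `t` in the region of decay of `1/A` with `B = -a`; the lower bound on `x²` gives `Re t ≥ 2`.
Only the zeros of the cosine have to be avoided. -/
lemma exists_norm_inv_zeta_strip_le {a : ℝ} (ha : a < 0) :
    ∃ M : ℝ, 0 < M ∧ ∀ z : ℂ, |z.im| ≤ 1 / 2 → 1 ≤ -4 * a * z.re ^ 2 →
      ∀ δ : ℝ, 0 < δ → δ ≤ ‖cos (Real.pi * (1 - (a : ℂ) * (4 * z ^ 2 + 1)) / 2)‖ →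
      ‖(riemannZeta (a * (4 * z ^ 2 + 1)))⁻¹‖ ≤ M / δ := by
  obtain ⟨M, hM, h⟩ := exists_norm_inv_zetaFactor_le (-a)
  refine ⟨M, hM, fun z hz hre δ hδ hcos => ?_⟩
  obtain ⟨h1, h2⟩ := re_im_one_sub a z
  set t : ℂ := 1 - (a : ℂ) * (4 * z ^ 2 + 1) with ht
  have h3 : z.im ^ 2 ≤ (1 / 2) ^ 2 := sq_le_sq' (by linarith [(abs_le.mp hz).1]) (abs_le.mp hz).2
  have h4 : 1 - 4 * a * z.re ^ 2 ≤ t.re := by rw [h1]; nlinarith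
  have ht2 : 2 ≤ t.re := by linarith
  have him : |t.im| ≤ t.re + -a := by
    have h5 : |t.im| = 8 * -a * |z.re| * |z.im| := by
      rw [h2, abs_mul, abs_mul, abs_mul, abs_of_neg ha]; norm_num
    have h6 : |t.im| ≤ 4 * -a * |z.re| := by
      rw [h5]
      have : 0 ≤ -a * |z.re| := mul_nonneg (by linarith) (abs_nonneg _)
      nlinarith
    have h7 : |z.re| ≤ z.re ^ 2 + 1 / 4 := by
      have := sq_nonneg (|z.re| - 1 / 2)
      nlinarith [sq_abs z.re]
    nlinarith
  have hb := h t ht2 him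
  have ht1 : t ≠ 1 := fun h0 => by rw [h0] at ht2; norm_num at ht2
  have hz := riemannZeta_one_sub_eq (t := t) (by linarith) ht1
  have hs : 1 - t = a * (4 * z ^ 2 + 1) := by rw [ht]; ring
  rw [hs] at hz
  rw [hz, mul_inv, norm_mul, norm_inv (cos _), ← div_eq_mul_inv]
  have h8 : Real.exp (-t.re) ≤ 1 := Real.exp_le_one_iff.mpr (by linarith)
  have h9 : ‖(zetaFactor t)⁻¹‖ ≤ M := hb.trans (mul_le_of_le_one_right hM.le h8)
  gcongr

lemma norm_stripKernel_le {a w : ℝ} (hw : 0 < w) (hw1 : w ≤ 1) {z : ℂ} (hz : |z.im| ≤ 1 / 2) :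
    ‖stripKernel a w z‖ ≤ ‖(riemannZeta (a * (4 * z ^ 2 + 1)))⁻¹‖ * ‖(sinh (Real.pi * z))⁻¹‖ := by
  rw [stripKernel, div_eq_mul_inv, mul_inv, norm_mul (I * _), norm_mul (riemannZeta _)⁻¹]
  exact mul_le_of_le_one_left (by positivity) (norm_numerator_le_one hw hw1 hz)

/-- The argument of ζ is `4av² + 4av·i`, which is real only at `v = 0`; there it is 0, not a trivial
zero. -/
lemma continuous_zetaKernel {a w : ℝ} (ha : a < 0) (hw : 0 < w) : Continuous (zetaKernel a w) := by
  have h : zetaKernel a w = fun v : ℝ => stripKernel a w (v + ((1 / 2 : ℝ) : ℂ) * I) :=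
    funext fun v => zetaKernel_eq_stripKernel a w v
  rw [h, continuous_iff_continuousAt]
  intro v
  have him : ((v : ℂ) + ((1 / 2 : ℝ) : ℂ) * I).im = 1 / 2 := by simp
  have him' : |((v : ℂ) + ((1 / 2 : ℝ) : ℂ) * I).im| ≤ 1 / 2 := by rw [him]; norm_num
  have hd : DifferentiableAt ℂ (stripKernel a w) (v + ((1 / 2 : ℝ) : ℂ) * I) := by
    refine differentiableAt_stripKernel ha hw him' (fun h => ?_) fun hζ => ?_
    · rw [h] at him; norm_num at him
    · obtain ⟨n, hn1, hn, -⟩ := exists_eq_zetaPole ha him' hζ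
      have h2 : (a : ℂ) * (4 * ((v : ℂ) + ((1 / 2 : ℝ) : ℂ) * I) ^ 2 + 1) =
          ((4 * a * v ^ 2 : ℝ) : ℂ) + ((4 * a * v : ℝ) : ℂ) * I := by
        push_cast; linear_combination (a : ℂ) * I_sq
      rw [h2] at hn
      have hi : 4 * a * v = 0 := by simpa [-ofReal_mul] using congrArg im hn
      have hv : v = 0 := by
        rcases mul_eq_zero.mp hi with h | h
        · exact absurd h (by linarith)
        · exact h
      have hr : 4 * a * v ^ 2 = -2 * (n : ℝ) := by simpa [-ofReal_mul] using congrArg re hn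
      rw [hv] at hr
      have : (1 : ℝ) ≤ n := by exact_mod_cast hn1
      linarith
  exact ContinuousAt.comp (f := fun v : ℝ => (v : ℂ) + ((1 / 2 : ℝ) : ℂ) * I) hd.continuousAt
    (by fun_prop)

lemma exists_norm_zetaKernel_le {a w : ℝ} (ha : a < 0) (hw : 0 < w) (hw1 : w ≤ 1) :
    ∃ C : ℝ, ∀ v : ℝ, ‖zetaKernel a w v‖ ≤ C * (1 + v ^ 2)⁻¹ := by
  obtain ⟨M, hM, h⟩ := exists_norm_inv_zeta_strip_le ha
  -- Beyond `V` both `|v| ≥ 1` and `-4av² ≥ 1` hold: the first makes the imaginary part `-2πav` of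
  -- the cosine's argument at least `-a` in modulus, the second is required by `h`.
  set V : ℝ := 1 + 1 / (-4 * a) with hV
  have ha4 : 0 < 1 / (-4 * a) := by apply one_div_pos.mpr; linarith
  obtain ⟨C, hC⟩ := (isCompact_Icc (a := -V) (b := V)).exists_bound_of_continuousOn
    (f := fun v : ℝ => zetaKernel a w v * ((1 + v ^ 2 : ℝ) : ℂ))
    ((continuous_zetaKernel ha hw).mul (by fun_prop)).continuousOn
  refine ⟨max C (M / (-a)), fun v => ?_⟩
  have hpos : 0 < 1 + v ^ 2 := by positivity
  rw [← div_eq_mul_inv, le_div_iff₀ hpos]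
  by_cases hv : |v| ≤ V
  · refine le_trans ?_ (le_max_left _ _)
    have := hC v (abs_le.mp hv)
    rwa [norm_mul, norm_real, Real.norm_of_nonneg hpos.le] at this
  · refine le_trans ?_ (le_max_right _ _)
    push Not at hv
    have hv1 : 1 ≤ |v| := by linarith
    set z : ℂ := (v : ℂ) + ((1 / 2 : ℝ) : ℂ) * I with hz
    have hre : z.re = v := by simp [hz]
    have him : z.im = 1 / 2 := by simp [hz]
    have him' : |z.im| ≤ 1 / 2 := by rw [him]; norm_num
    have hv2 : 1 / (-4 * a) ≤ v ^ 2 := by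
      rw [← sq_abs]; nlinarith
    have hlarge : 1 ≤ -4 * a * z.re ^ 2 := by
      rw [hre]
      rwa [div_le_iff₀ (by linarith), mul_comm] at hv2
    obtain ⟨-, hti⟩ := re_im_one_sub a z
    have hcos : -a ≤ ‖cos (Real.pi * (1 - (a : ℂ) * (4 * z ^ 2 + 1)) / 2)‖ := by
      refine le_trans ?_ (abs_sinh_im_le_norm_cos _)
      refine le_trans ?_ (abs_le_abs_sinh _)
      have : (Real.pi * (1 - (a : ℂ) * (4 * z ^ 2 + 1)) / 2).im = Real.pi * (-4 * a * v) / 2 := by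
        rw [show (Real.pi * (1 - (a : ℂ) * (4 * z ^ 2 + 1)) / 2 : ℂ) =
          ((Real.pi / 2 : ℝ) : ℂ) * (1 - (a : ℂ) * (4 * z ^ 2 + 1)) by push_cast; ring,
          im_ofReal_mul, hti, hre, him]
        ring
      rw [this, show Real.pi * (-4 * a * v) / 2 = (2 * Real.pi * -a) * v by ring, abs_mul,
        abs_of_nonneg (by have := Real.pi_pos; nlinarith)]
      have h3 : 1 ≤ 2 * Real.pi * |v| := by nlinarith [Real.pi_gt_three]
      nlinarith
    have hb := h z him' hlarge (-a) (by linarith) hcos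
    have hs : ‖sinh (Real.pi * z)‖ = Real.cosh (Real.pi * v) := by
      have : sinh (Real.pi * z) = I * ((Real.cosh (Real.pi * v) : ℝ) : ℂ) := by
        have e : (Real.pi : ℂ) * z = Real.pi * v + (Real.pi / 2) * I := by
          rw [hz]; push_cast; ring
        rw [e, Complex.sinh_add, Complex.cosh_mul_I, Complex.sinh_mul_I, Complex.cos_pi_div_two,
          Complex.sin_pi_div_two]
        push_cast; ring
      rw [this, norm_mul, norm_I, one_mul, norm_real, Real.norm_of_nonneg (Real.cosh_pos _).le]
    have hcosh : 1 + v ^ 2 ≤ Real.cosh (Real.pi * v) := by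
      have h4 : Real.cosh (Real.pi * v) = 1 + 2 * Real.sinh (Real.pi * v / 2) ^ 2 := by
        have := Real.cosh_two_mul (Real.pi * v / 2)
        rw [show 2 * (Real.pi * v / 2) = Real.pi * v by ring, Real.cosh_sq] at this
        linarith
      have h5 := sq_le_sq.mpr (abs_le_abs_sinh (Real.pi * v / 2))
      have h6 : v ^ 2 ≤ (Real.pi * v / 2) ^ 2 := by
        have : 1 ≤ Real.pi / 2 := by linarith [Real.pi_gt_three]
        rw [show Real.pi * v / 2 = Real.pi / 2 * v by ring, mul_pow]
        exact le_mul_of_one_le_left (sq_nonneg v) (one_le_pow₀ this)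
      rw [h4]
      nlinarith [sq_nonneg v]
    have hk := norm_stripKernel_le (a := a) hw hw1 him'
    rw [zetaKernel_eq_stripKernel, ← hz]
    rw [norm_inv (sinh _), hs] at hk
    calc ‖stripKernel a w z‖ * (1 + v ^ 2)
        ≤ (M / -a * (Real.cosh (Real.pi * v))⁻¹) * Real.cosh (Real.pi * v) := by
          refine mul_le_mul (hk.trans ?_) hcosh hpos.le ?_
          · have := Real.cosh_pos (Real.pi * v)
            gcongr
          · exact (norm_nonneg _).trans (hk.trans (by have := Real.cosh_pos (Real.pi * v); gcongr))
      _ = M / -a := by rw [inv_mul_cancel_right₀ (Real.cosh_pos _).ne']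

lemma integrable_zetaKernel {a w : ℝ} (ha : a < 0) (hw : 0 < w) (hw1 : w ≤ 1) :
    Integrable (zetaKernel a w) := by
  obtain ⟨C, hC⟩ := exists_norm_zetaKernel_le ha hw hw1
  exact (integrable_inv_one_add_sq.const_mul C).mono'
    (continuous_zetaKernel ha hw).aestronglyMeasurable (Eventually.of_forall hC)

/-- At the midpoint of the edge the cosine is `cos(kπ) = ±1`, and it stays at least 1/2 in modulus
along the edge. The factor `1/R` comes from `sinh(πz)`. -/
lemma exists_norm_stripKernel_vertical_le {a w : ℝ} (ha : a < 0) (hw : 0 < w) (hw1 : w ≤ 1) :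
    ∃ M : ℝ, 0 < M ∧ ∀ (R : ℝ) (k : ℕ), 0 < R → 1 ≤ -a * R ^ 2 →
      -a * (4 * R ^ 2 + 1) + 1 = 2 * k → ∀ y : ℝ, |y| ≤ 1 / 2 →
      ‖stripKernel a w (R + y * I)‖ ≤ M / R := by
  obtain ⟨M, hM, h⟩ := exists_norm_inv_zeta_strip_le ha
  refine ⟨2 * M, by positivity, fun R k hR haR hk y hy => ?_⟩
  set z : ℂ := (R : ℂ) + y * I with hz
  have hre : z.re = R := by simp [hz]
  have him : z.im = y := by simp [hz]
  have him' : |z.im| ≤ 1 / 2 := by rwa [him]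
  obtain ⟨htr, hti⟩ := re_im_one_sub a z
  rw [hre, him] at htr hti
  have hu : (Real.pi * (1 - (a : ℂ) * (4 * z ^ 2 + 1)) / 2 : ℂ) =
      ((Real.pi / 2 : ℝ) : ℂ) * (1 - (a : ℂ) * (4 * z ^ 2 + 1)) := by push_cast; ring
  have hcos : 1 / 2 ≤ ‖cos (Real.pi * (1 - (a : ℂ) * (4 * z ^ 2 + 1)) / 2)‖ := by
    -- Either the imaginary part of the cosine's argument is large, or `y² ≤ 1/(64a²R²)` and its
    -- real part is within `2π|a|y² ≤ 1` of `kπ`.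
    rcases le_total 1 |-8 * a * R * y| with hc | hc
    · refine le_trans ?_ (abs_sinh_im_le_norm_cos _)
      refine le_trans ?_ (abs_le_abs_sinh _)
      rw [hu, im_ofReal_mul, hti, abs_mul, abs_of_pos (by positivity)]
      nlinarith [Real.pi_gt_three]
    · refine le_trans ?_ (abs_cos_re_le_norm_cos _)
      have h1 : Real.pi / 2 * (1 - a * (4 * (R ^ 2 - y ^ 2) + 1)) =
          k * Real.pi - 2 * Real.pi * (-a * y ^ 2) := by
        have : 1 - a * (4 * (R ^ 2 - y ^ 2) + 1) = 2 * k - 4 * (-a * y ^ 2) := by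
          rw [← hk]; ring
        rw [this]; ring
      rw [hu, re_ofReal_mul, htr, h1, Real.cos_nat_mul_pi_sub, abs_mul, abs_pow, abs_neg, abs_one,
        one_pow, one_mul]
      refine le_trans ?_ (le_abs_self _)
      have h2 : (-8 * a * R * y) ^ 2 ≤ 1 := by
        rw [← sq_abs]; exact pow_le_one₀ (abs_nonneg _) hc
      have h3 : 0 ≤ -a * y ^ 2 := mul_nonneg (by linarith) (sq_nonneg y)
      have h4 : 64 * (-a * y ^ 2) ≤ 1 := by
        have : 64 * (-a * y ^ 2) * (-a * R ^ 2) ≤ 1 := by nlinarith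
        nlinarith
      have h5 : 2 * Real.pi * (-a * y ^ 2) ≤ 1 := by nlinarith [Real.pi_lt_four]
      have h6 : 0 ≤ 2 * Real.pi * (-a * y ^ 2) := by have := Real.pi_pos; positivity
      have := Real.one_sub_sq_div_two_le_cos (x := 2 * Real.pi * (-a * y ^ 2))
      nlinarith
  have hb := h z him' (by rw [hre]; linarith) (1 / 2) (by norm_num) hcos
  have hs : R ≤ ‖sinh (Real.pi * z)‖ := by
    refine le_trans ?_ (abs_sinh_re_le_norm_sinh _)
    refine le_trans ?_ (abs_le_abs_sinh _)
    rw [re_ofReal_mul, hre, abs_of_pos (by positivity)]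
    nlinarith [Real.pi_gt_three]
  calc ‖stripKernel a w z‖
      ≤ ‖(riemannZeta (a * (4 * z ^ 2 + 1)))⁻¹‖ * ‖(sinh (Real.pi * z))⁻¹‖ :=
        norm_stripKernel_le hw hw1 him'
    _ ≤ M / (1 / 2) * R⁻¹ := by
        rw [norm_inv (sinh _)]
        gcongr
    _ = 2 * M / R := by ring

/-! ### The residue series and the limit of large rectangles. -/

/-- The residue at the `n`-th pole, or `0` if there is none besides `0`. -/
noncomputable def residueTerm (a w : ℝ) (n : ℕ) : ℂ :=
  open Classical in if 1 ≤ n ∧ (2 * n : ℝ) ≠ -a then kernelResidue a w (zetaPole a n) else 0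

lemma sum_poleIndices (a w : ℝ) (k : ℕ) :
    ∑ n ∈ poleIndices a k, kernelResidue a w (zetaPole a n) =
      ∑ n ∈ Finset.range k, residueTerm a w n := by
  classical
  rw [poleIndices, Finset.sum_filter]
  refine Finset.sum_congr rfl fun n _ => ?_
  simp only [residueTerm]

lemma summable_residueTerm {a w : ℝ} (ha : a < 0) (hw : 0 < w) (hw1 : w ≤ 1) :
    Summable (residueTerm a w) := by
  obtain ⟨M, hM, h⟩ := exists_norm_inv_deriv_riemannZeta_le
  have hg : Summable fun n : ℕ => M * -a * Real.exp (-n) :=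
    (Real.summable_exp_neg_nat).mul_left _
  refine Summable.of_norm_bounded_eventually_nat hg ?_
  -- From this index on the radicand is at least 1, so the pole is real and both `8a·p_n` and
  -- `sinh(π p_n)` are bounded away from 0; the decay of `1/ζ'(-2n)` does the rest.
  filter_upwards [eventually_ge_atTop (⌈(1 + a ^ 2) / (-2 * a)⌉₊), eventually_ge_atTop 1]
    with n hn hn1
  have hq : 1 ≤ -a ^ 2 - 2 * a * n := by
    have := Nat.ceil_le.mp hn
    rw [div_le_iff₀ (by linarith)] at this
    linarith
  unfold residueTerm
  split_ifs with hc
  swap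
  · rw [norm_zero]
    have : 0 ≤ -a := by linarith
    positivity
  have hz := mul_four_zetaPole_sq_add_one ha n
  have hp : zetaPole a n = ((√(-a ^ 2 - 2 * a * n) / (2 * a) : ℝ) : ℂ) := by
    rw [zetaPole, if_pos (by linarith)]
  have hnum := norm_numerator_le_one hw hw1 (z := zetaPole a n)
    (by rw [hp, ofReal_im]; norm_num)
  rw [kernelResidue, hz, div_eq_mul_inv, mul_inv, mul_inv, norm_mul (I * _),
    norm_mul (_ * _) (sinh _)⁻¹, norm_mul (deriv _ _)⁻¹]
  have hsq : 1 ≤ √(-a ^ 2 - 2 * a * n) := Real.one_le_sqrt.mpr hq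
  set q := √(-a ^ 2 - 2 * a * n) with hqdef
  have h1 : ‖((8 : ℂ) * a * zetaPole a n)⁻¹‖ ≤ 1 := by
    have e : (8 : ℂ) * a * zetaPole a n = ((4 * q : ℝ) : ℂ) := by
      have ha' : (a : ℂ) ≠ 0 := ofReal_ne_zero.mpr ha.ne
      rw [hp]; push_cast; field_simp; ring
    rw [e, norm_inv, norm_real, Real.norm_of_nonneg (by linarith)]
    exact inv_le_one_of_one_le₀ (by linarith)
  have h2 : ‖(sinh (Real.pi * zetaPole a n))⁻¹‖ ≤ -a := by
    have h3 : (-a)⁻¹ ≤ ‖sinh (Real.pi * zetaPole a n)‖ := by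
      refine le_trans ?_ (abs_sinh_re_le_norm_sinh _)
      refine le_trans ?_ (abs_le_abs_sinh _)
      rw [re_ofReal_mul, hp, ofReal_re, abs_mul, abs_of_pos Real.pi_pos, abs_div,
        abs_of_pos (by linarith), abs_of_neg (by linarith : 2 * a < 0)]
      have : Real.pi * (q / -(2 * a)) = Real.pi * q / 2 * (-a)⁻¹ := by field_simp
      rw [this]
      have hi : 0 ≤ (-a)⁻¹ := inv_nonneg.mpr (by linarith)
      refine le_mul_of_one_le_left hi ?_
      nlinarith [Real.pi_gt_three]
    rw [norm_inv]
    exact inv_le_of_inv_le₀ (by linarith) h3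
  calc _ ≤ 1 * (M * Real.exp (-n) * 1 * -a) := by
        gcongr
        exact h n hn1
    _ = _ := by ring

theorem integral_zetaKernel_eq {a w : ℝ} (ha : a < 0) (hw : 0 < w) (hw1 : w ≤ 1) {c₀ c₃ : ℂ}
    (hlim : Tendsto (fun z => z * (stripKernel a w z - c₃ * (z ^ 3)⁻¹)) (𝓝[≠] 0) (𝓝 c₀)) :
    ∫ v : ℝ, zetaKernel a w v = -Real.pi * I * (c₀ + 2 * ∑' n, residueTerm a w n) := by
  obtain ⟨M, hM, hv⟩ := exists_norm_stripKernel_vertical_le ha hw hw1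
  have ha' : a ≠ 0 := ha.ne
  -- The solution of `-a(4R² + 1) + 1 = 2k`. For small `k` the radicand may be negative and the root
  -- is 0 by default, which is harmless in the limit.
  set R : ℕ → ℝ := fun k => √((2 * k - 1 + a) / (-4 * a)) with hR
  have hRlim : Tendsto R atTop atTop := by
    refine Real.tendsto_sqrt_atTop.comp ?_
    refine Tendsto.atTop_div_const (by linarith) ?_
    have : Tendsto (fun k : ℕ => (2 * (k : ℝ))) atTop atTop :=
      tendsto_natCast_atTop_atTop.const_mul_atTop (by norm_num)
    refine (tendsto_atTop_add_const_right _ (-1 + a) this).congr fun k => by ring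
  have hRpos : ∀ᶠ k in atTop, 0 < R k ∧ 1 ≤ -a * R k ^ 2 ∧
      -a * (4 * R k ^ 2 + 1) + 1 = 2 * k := by
    filter_upwards [hRlim.eventually_ge_atTop (1 + (-a)⁻¹)] with k hk
    have hi : 0 < (-a)⁻¹ := inv_pos.mpr (by linarith)
    have hpos : 0 < R k := by linarith
    refine ⟨hpos, ?_, ?_⟩
    · have h1 : (-a)⁻¹ ≤ R k ^ 2 := by nlinarith
      rwa [inv_le_iff_one_le_mul₀' (by linarith)] at h1
    · have h2 : R k ^ 2 = (2 * k - 1 + a) / (-4 * a) := by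
        have h3 : 0 < (2 * k - 1 + a) / (-4 * a) := Real.sqrt_pos.mp hpos
        rw [hR]; exact Real.sq_sqrt h3.le
      rw [h2]
      field_simp
      ring
  have hI : Tendsto (fun k => ∫ v : ℝ in -R k..R k, zetaKernel a w v) atTop
      (𝓝 (∫ v : ℝ, zetaKernel a w v)) :=
    intervalIntegral_tendsto_integral (integrable_zetaKernel ha hw hw1)
      (tendsto_neg_atTop_atBot.comp hRlim) hRlim
  have hV : Tendsto (fun k => ∫ y : ℝ in -(1 / 2)..(1 / 2), stripKernel a w (R k + y * I)) atTop
      (𝓝 0) := by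
    have h0 : Tendsto (fun k => M / R k) atTop (𝓝 0) := hRlim.const_div_atTop M
    refine squeeze_zero_norm' ?_ h0
    filter_upwards [hRpos] with k ⟨h1, h2, h3⟩
    have := intervalIntegral.norm_integral_le_of_norm_le_const (a := -(1 / 2)) (b := 1 / 2)
      (C := M / R k) (f := fun y : ℝ => stripKernel a w (R k + y * I)) fun y hy => by
        rw [uIoc_of_le (by norm_num)] at hy
        exact hv (R k) k h1 h2 h3 y (abs_le.mpr ⟨hy.1.le, hy.2⟩)
    refine this.trans_eq ?_
    norm_num
  have hS : Tendsto (fun k => ∑ n ∈ poleIndices a k, kernelResidue a w (zetaPole a n)) atTop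
      (𝓝 (∑' n, residueTerm a w n)) := by
    simp only [sum_poleIndices]
    exact (summable_residueTerm ha hw hw1).hasSum.tendsto_sum_nat
  have hl := (hI.const_mul (-2 : ℂ)).add (hV.const_mul (2 * I))
  have hr := ((hS.const_mul 2).const_add c₀).const_mul (2 * Real.pi * I)
  have heq : ∀ᶠ k in atTop, -2 * (∫ v : ℝ in -R k..R k, zetaKernel a w v) +
      2 * I * (∫ y : ℝ in -(1 / 2)..(1 / 2), stripKernel a w (R k + y * I)) =
      2 * Real.pi * I *
        (c₀ + 2 * ∑ n ∈ poleIndices a k, kernelResidue a w (zetaPole a n)) := by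
    filter_upwards [hRpos] with k ⟨h1, h2, h3⟩
    rw [← rectIntegral_stripKernel ha hw h1 h3 hlim, rectIntegral_stripKernel_eq_integral]
  have := tendsto_nhds_unique (hl.congr' heq) hr
  linear_combination (-1 / 2 : ℂ) * this

/-! ### The residue at 0. -/

lemma AnalyticAt.tendsto_taylor_remainder {f : ℂ → ℂ} {c : ℂ} (hf : AnalyticAt ℂ f c) (n : ℕ) :
    Tendsto (fun s => (f (c + s) -
      ∑ k ∈ Finset.range n, iteratedDeriv k f c / k.factorial * s ^ k) / s ^ n) (𝓝[≠] 0)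
      (𝓝 (iteratedDeriv n f c / n.factorial)) := by
  have h := hf.hasFPowerSeriesAt.isBigO_sub_partialSum_pow (n + 1)
  have h1 : (fun s => f (c + s) - ∑ k ∈ Finset.range (n + 1),
      iteratedDeriv k f c / k.factorial * s ^ k) =o[𝓝 0] fun s => s ^ n := by
    refine Asymptotics.IsBigO.trans_isLittleO (g := fun s : ℂ => s ^ (n + 1)) ?_
      (Asymptotics.isLittleO_pow_pow n.lt_succ_self)
    rw [← Asymptotics.isBigO_norm_right]
    simp only [norm_pow]
    refine h.congr_left fun s => ?_
    congr 1
    simp only [FormalMultilinearSeries.partialSum]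
    refine Finset.sum_congr rfl fun k _ => ?_
    simp [mul_comm]
  have h2 := (h1.mono (nhdsWithin_le_nhds (s := {(0 : ℂ)}ᶜ))).tendsto_div_nhds_zero
  have h3 := h2.add_const (iteratedDeriv n f c / n.factorial)
  rw [zero_add] at h3
  refine h3.congr' ?_
  filter_upwards [self_mem_nhdsWithin] with s hs
  have hs' : s ^ n ≠ 0 := pow_ne_zero _ hs
  rw [Finset.sum_range_succ]
  field_simp
  ring

lemma tendsto_const_mul_sq {c : ℂ} (hc : c ≠ 0) :
    Tendsto (fun z : ℂ => c * z ^ 2) (𝓝[≠] 0) (𝓝[≠] 0) := by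
  refine tendsto_nhdsWithin_iff.mpr ⟨?_, ?_⟩
  · have : ContinuousAt (fun z : ℂ => c * z ^ 2) 0 := by fun_prop
    simpa [ContinuousAt] using this.tendsto.mono_left nhdsWithin_le_nhds
  · filter_upwards [self_mem_nhdsWithin] with z hz
    exact mul_ne_zero hc (pow_ne_zero 2 hz)

lemma tendsto_cpow_sq_sub_one_div {w : ℝ} (hw : 0 < w) :
    Tendsto (fun z : ℂ => ((w : ℂ) ^ (z ^ 2) - 1) / z ^ 2) (𝓝[≠] 0) (𝓝 (log w)) := by
  have hw' : (w : ℂ) ≠ 0 := ofReal_ne_zero.mpr hw.ne'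
  have h1 : HasDerivAt (fun u : ℂ => (w : ℂ) ^ u) (log w) 0 := by
    simpa using (hasDerivAt_id (0 : ℂ)).const_cpow (c := (w : ℂ)) (Or.inl hw')
  have h2 := (hasDerivAt_iff_tendsto_slope.mp h1).comp (tendsto_const_mul_sq one_ne_zero)
  refine h2.congr fun z => ?_
  simp [slope_def_field]

lemma tendsto_sinh_pi_mul_div {x : ℂ} (hx : x ≠ 0) :
    Tendsto (fun z : ℂ => (sinh (x * z) / z - x) / z ^ 2) (𝓝[≠] 0) (𝓝 (x ^ 3 / 6)) := by
  have h := (Complex.differentiable_sinh.analyticAt 0).tendsto_taylor_remainder 3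
  have h2 : Tendsto (fun z : ℂ => x * z) (𝓝[≠] 0) (𝓝[≠] 0) := by
    refine tendsto_nhdsWithin_iff.mpr ⟨?_, ?_⟩
    · have : ContinuousAt (fun z : ℂ => x * z) 0 := by fun_prop
      simpa [ContinuousAt] using this.tendsto.mono_left nhdsWithin_le_nhds
    · filter_upwards [self_mem_nhdsWithin] with z hz
      exact mul_ne_zero hx hz
  have h3 := (h.comp h2).const_mul (x ^ 3)
  have e : x ^ 3 * (iteratedDeriv 3 sinh 0 / (Nat.factorial 3 : ℕ)) = x ^ 3 / 6 := by
    simp [iteratedDeriv_succ, Nat.factorial]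
    ring
  rw [e] at h3
  refine h3.congr' ?_
  filter_upwards [self_mem_nhdsWithin] with z hz
  have hz' : z ≠ 0 := hz
  simp [Finset.sum_range_succ, iteratedDeriv_succ]
  field_simp

/-- The argument is `a + 4az²`, so this is the second-order Taylor expansion of ζ at its zero `a`,
in the increment `4az²`. -/
lemma tendsto_zeta_div_sq {a : ℂ} (ha : a ≠ 0) (ha1 : a ≠ 1) (h0 : riemannZeta a = 0) :
    Tendsto (fun z : ℂ => (riemannZeta (a * (4 * z ^ 2 + 1)) / z ^ 2 - 4 * a * deriv riemannZeta a)
      / z ^ 2) (𝓝[≠] 0) (𝓝 (8 * a ^ 2 * iteratedDeriv 2 riemannZeta a)) := by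
  have han : AnalyticAt ℂ riemannZeta a := analyticOn_riemannZeta a ha1
  have h := han.tendsto_taylor_remainder 2
  have ha4 : 4 * a ≠ 0 := mul_ne_zero (by norm_num) ha
  have h3 := (h.comp (tendsto_const_mul_sq ha4)).const_mul (16 * a ^ 2)
  have e : 16 * a ^ 2 * (iteratedDeriv 2 riemannZeta a / (Nat.factorial 2 : ℕ)) =
      8 * a ^ 2 * iteratedDeriv 2 riemannZeta a := by
    simp [Nat.factorial]
    ring
  rw [e] at h3
  refine h3.congr' ?_
  filter_upwards [self_mem_nhdsWithin] with z hz
  have hz' : z ≠ 0 := hz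
  have harg : a + 4 * a * z ^ 2 = a * (4 * z ^ 2 + 1) := by ring
  simp only [Function.comp_apply, Finset.sum_range_succ, Finset.range_zero, Finset.sum_empty,
    iteratedDeriv_zero, iteratedDeriv_one, harg, h0]
  simp
  field_simp
  ring

lemma tendsto_of_tendsto_sub_div_sq {f : ℂ → ℂ} {b l : ℂ}
    (h : Tendsto (fun z : ℂ => (f z - b) / z ^ 2) (𝓝[≠] 0) (𝓝 l)) :
    Tendsto f (𝓝[≠] 0) (𝓝 b) := by
  have h1 : Tendsto (fun z : ℂ => z ^ 2) (𝓝[≠] 0) (𝓝 0) := by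
    have : ContinuousAt (fun z : ℂ => z ^ 2) 0 := by fun_prop
    simpa [ContinuousAt] using this.tendsto.mono_left nhdsWithin_le_nhds
  have h2 := (h.mul h1).add_const b
  rw [mul_zero, zero_add] at h2
  refine h2.congr' ?_
  filter_upwards [self_mem_nhdsWithin] with z hz
  rw [div_mul_cancel₀ _ (pow_ne_zero 2 hz), sub_add_cancel]

lemma tendsto_mul_stripKernel_simple {a w : ℝ} (ha : a < 0) (hw : 0 < w)
    (hζ : riemannZeta (a : ℂ) ≠ 0) :
    Tendsto (fun z => z * (stripKernel a w z - 0 * (z ^ 3)⁻¹)) (𝓝[≠] 0)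
      (𝓝 (I * ((w ^ (1 / 4 : ℝ) : ℝ) : ℂ) / riemannZeta a / Real.pi)) := by
  have h0 : |(0 : ℂ).im| ≤ 1 / 2 := by norm_num
  have he : (a : ℂ) * (4 * (0 : ℂ) ^ 2 + 1) = a := by ring
  have hN : ContinuousAt (fun z : ℂ => I * (w : ℂ) ^ (z ^ 2 + 1 / 4) /
      riemannZeta (a * (4 * z ^ 2 + 1))) 0 :=
    ((differentiableAt_numerator hw 0).div (hasDerivAt_zeta_comp ha h0).differentiableAt
      (by rwa [he])).continuousAt
  have := tendsto_sub_mul_div hN (hasDerivAt_sinh_pi_mul 0) (by simp) (by simp)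
  have hw4 : (w : ℂ) ^ ((0 : ℂ) ^ 2 + 1 / 4) = ((w ^ (1 / 4 : ℝ) : ℝ) : ℂ) := by
    rw [ofReal_cpow hw.le]; norm_num
  rw [he, hw4, mul_zero, Complex.cosh_zero, one_mul] at this
  refine this.congr fun z => ?_
  rw [sub_zero, zero_mul, sub_zero, stripKernel, div_div]

/-- With `W = w^(z²)`, `D₁ = ζ/z² → A = 4aζ'(a)` and `D₂ = sinh(πz)/z → π`, the function is `i
w^(1/4)` times `(W - 1)/(z² D₁D₂) - ((D₁ - A)D₂ + A(D₂ - π))/(z² D₁D₂Aπ)`, in which every difference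
quotient has a known limit. -/
lemma tendsto_mul_stripKernel_triple {a w : ℝ} (ha : a < 0) (hw : 0 < w)
    (hζ : riemannZeta (a : ℂ) = 0) (hζ' : deriv riemannZeta (a : ℂ) ≠ 0) :
    Tendsto (fun z => z * (stripKernel a w z -
        I * ((w ^ (1 / 4 : ℝ) : ℝ) : ℂ) / (4 * a * deriv riemannZeta a * Real.pi) * (z ^ 3)⁻¹))
      (𝓝[≠] 0)
      (𝓝 (I * ((w ^ (1 / 4 : ℝ) : ℝ) : ℂ) *
        (Real.log w / (4 * a * deriv riemannZeta a * Real.pi) -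
          (8 * a ^ 2 * iteratedDeriv 2 riemannZeta a * Real.pi +
            4 * a * deriv riemannZeta a * (Real.pi ^ 3 / 6)) /
          (4 * a * deriv riemannZeta a * Real.pi * (4 * a * deriv riemannZeta a * Real.pi))))) := by
  have ha' : (a : ℂ) ≠ 0 := ofReal_ne_zero.mpr ha.ne
  have ha1 : (a : ℂ) ≠ 1 := by exact_mod_cast (by linarith : a < 1).ne
  have hpi : (Real.pi : ℂ) ≠ 0 := ofReal_ne_zero.mpr Real.pi_ne_zero
  have h1 := tendsto_cpow_sq_sub_one_div hw
  have h2 := tendsto_zeta_div_sq ha' ha1 hζ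
  have h3 := tendsto_sinh_pi_mul_div hpi
  set A : ℂ := 4 * a * deriv riemannZeta a with hA
  have hA0 : A ≠ 0 := mul_ne_zero (mul_ne_zero (by norm_num) ha') hζ'
  have h2' := tendsto_of_tendsto_sub_div_sq h2
  have h3' := tendsto_of_tendsto_sub_div_sq h3
  have hne : A * Real.pi ≠ 0 := mul_ne_zero hA0 hpi
  have hprod := h2'.mul h3'
  have hlim := ((h1.div hprod hne).sub (((h2.mul h3').add (h3.const_mul A)).div
    (hprod.mul_const (A * Real.pi)) (mul_ne_zero hne hne))).const_mul
      (I * ((w ^ (1 / 4 : ℝ) : ℝ) : ℂ))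
  rw [← ofReal_log hw.le] at hlim
  refine hlim.congr' ?_
  filter_upwards [self_mem_nhdsWithin, h2'.eventually_ne hA0, h3'.eventually_ne hpi]
    with z hz hD1 hD2
  have hz' : z ≠ 0 := hz
  have hw' : (w : ℂ) ≠ 0 := ofReal_ne_zero.mpr hw.ne'
  have hnum : (w : ℂ) ^ (z ^ 2 + 1 / 4) = (w : ℂ) ^ (z ^ 2) * ((w ^ (1 / 4 : ℝ) : ℝ) : ℂ) := by
    rw [cpow_add _ _ hw', ofReal_cpow hw.le]; norm_num
  simp only [Pi.div_apply, stripKernel, hnum]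
  have hD1' : riemannZeta (a * (4 * z ^ 2 + 1)) ≠ 0 := fun h => hD1 (by rw [h, zero_div])
  have hD2' : sinh (Real.pi * z) ≠ 0 := fun h => hD2 (by rw [h, zero_div])
  generalize riemannZeta (a * (4 * z ^ 2 + 1)) = D1 at *
  generalize sinh (Real.pi * z) = D2 at *
  generalize (w : ℂ) ^ (z ^ 2) = W
  generalize ((w ^ (1 / 4 : ℝ) : ℝ) : ℂ) = W4
  clear_value A
  field_simp
  ring

/-! ### Matching residues with the stated terms, and the two cases. -/

lemma cpow_zetaPole_sq {a w : ℝ} (ha : a < 0) (hw : 0 < w) (n : ℕ) :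
    (w : ℂ) ^ (zetaPole a n ^ 2 + 1 / 4) = ((w ^ (-(n : ℝ) / (2 * a)) : ℝ) : ℂ) := by
  have ha' : (a : ℂ) ≠ 0 := ofReal_ne_zero.mpr ha.ne
  have h := mul_four_zetaPole_sq_add_one ha n
  rw [ofReal_cpow hw.le]
  congr 1
  push_cast
  field_simp
  linear_combination 2 * h

/-- The sign of the root in `zetaPole` makes `π p_n` the argument of sinh in the stated term, and
`8a·p_n` is four times its square root. -/
lemma residueTerm_eq_sinhTerm {a w : ℝ} (ha : a < 0) (hw : 0 < w) {n : ℕ} (hn : -a < 2 * n) :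
    residueTerm a w n = I / 4 * sinhTerm a w n := by
  have ha' : (a : ℂ) ≠ 0 := ofReal_ne_zero.mpr ha.ne
  have hn1 : 1 ≤ n := by
    have : (0 : ℝ) < n := by linarith
    exact_mod_cast this
  have hpos : 0 ≤ -a ^ 2 - 2 * a * n := by nlinarith
  rw [residueTerm, if_pos ⟨hn1, hn.ne'⟩, kernelResidue, cpow_zetaPole_sq ha hw,
    mul_four_zetaPole_sq_add_one ha, sinhTerm]
  have hp : zetaPole a n = ((√(-a ^ 2 - 2 * a * n) / (2 * a) : ℝ) : ℂ) := by
    rw [zetaPole, if_pos hpos]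
  have hs : sinh (Real.pi * zetaPole a n) =
      ((Real.sinh (Real.pi * √(-a ^ 2 - 2 * a * n) / (2 * a)) : ℝ) : ℂ) := by
    rw [hp, ← ofReal_mul, ← ofReal_sinh, mul_div_assoc]
  have h8 : 8 * (a : ℂ) * zetaPole a n = 4 * ((√(-a ^ 2 - 2 * a * n) : ℝ) : ℂ) := by
    rw [hp]; push_cast; field_simp; ring
  rw [hs, h8, ofReal_mul (√_)]
  rw [show ∀ x y z : ℂ, x * (4 * y) * z = 4 * (x * (y * z)) from fun x y z => by ring,
    ← div_mul_div_comm]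

lemma residueTerm_eq_sinTerm {a w : ℝ} (ha : a < 0) (hw : 0 < w) {n : ℕ} (hn1 : 1 ≤ n)
    (hn : 2 * n < -a) : residueTerm a w n = -(I / 4 * sinTerm a w n) := by
  have ha' : (a : ℂ) ≠ 0 := ofReal_ne_zero.mpr ha.ne
  have hneg : ¬ 0 ≤ -a ^ 2 - 2 * a * n := by nlinarith
  rw [residueTerm, if_pos ⟨hn1, hn.ne⟩, kernelResidue, cpow_zetaPole_sq ha hw,
    mul_four_zetaPole_sq_add_one ha, sinTerm]
  have hp : zetaPole a n = ((√(a ^ 2 + 2 * a * n) / (2 * a) : ℝ) : ℂ) * I := by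
    rw [zetaPole, if_neg hneg, mul_comm]
  have hs : sinh (Real.pi * zetaPole a n) =
      ((Real.sin (Real.pi * √(a ^ 2 + 2 * a * n) / (2 * a)) : ℝ) : ℂ) * I := by
    rw [hp, ← mul_assoc, Complex.sinh_mul_I, ← ofReal_mul, ← ofReal_sin, mul_div_assoc]
  have h8 : 8 * (a : ℂ) * zetaPole a n = 4 * ((√(a ^ 2 + 2 * a * n) : ℝ) : ℂ) * I := by
    rw [hp]; push_cast; field_simp; ring
  rw [hs, h8, ofReal_mul (√_)]
  rw [show ∀ x y z : ℂ, x * (4 * y * I) * (z * I) = -4 * (x * (y * z)) from fun x y z => by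
    linear_combination 4 * x * y * z * I_sq, ← div_mul_div_comm]
  ring

lemma residueTerm_zero (a w : ℝ) : residueTerm a w 0 = 0 := by
  simp [residueTerm]

/-- Equality fails at `v = 0`, where `0 ^ 0 = 1`; a single point does not affect the integral. -/
lemma zetaKernel_zero_ae (a : ℝ) : zetaKernel a 0 =ᵐ[volume] fun _ => 0 := by
  have : ∀ᵐ v : ℝ, v ≠ 0 := by simp [ae_iff]
  filter_upwards [this] with v hv
  have h : (v : ℂ) ^ 2 + I * v ≠ 0 := by
    intro h
    have := congrArg im h
    rw [← ofReal_pow] at this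
    simp [-ofReal_pow] at this
    exact hv this
  rw [zetaKernel, ofReal_zero, zero_cpow h, zero_div]

theorem integral_zetaKernel_generic {a w : ℝ} (hw0 : 0 ≤ w) (hw1 : w ≤ 1) (ha : a < 0)
    (hk : ∀ k : ℕ, a ≠ -(k : ℝ)) :
    Integrable (zetaKernel a w) ∧
      Summable (fun n : Set.Ici ⌈-a / 2⌉₊ => sinhTerm a w n) ∧
      ∫ v : ℝ, zetaKernel a w v =
        ((w ^ (1 / 4 : ℝ) : ℝ) : ℂ) / riemannZeta (a : ℂ)
          + (Real.pi : ℂ) / 2 * ∑' n : Set.Ici ⌈-a / 2⌉₊, sinhTerm a w n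
          - (Real.pi : ℂ) / 2 * ∑ n ∈ Finset.Icc 1 ⌊-a / 2⌋₊, sinTerm a w n := by
  have hN : ∀ n : ℕ, ⌈-a / 2⌉₊ ≤ n → -a < 2 * n := by
    intro n hn
    have h1 := Nat.ceil_le.mp hn
    refine lt_of_le_of_ne (by linarith) fun h => hk (2 * n) ?_
    push_cast; linarith
  rcases hw0.eq_or_lt with rfl | hw
  · have hs : ∀ n : Set.Ici ⌈-a / 2⌉₊, sinhTerm a 0 n = 0 := by
      rintro ⟨n, hn⟩
      have : (0 : ℝ) < n := by linarith [hN n hn]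
      have hne : -(n : ℝ) / (2 * a) ≠ 0 :=
        div_ne_zero (by linarith) (by linarith)
      simp only [sinhTerm, Real.zero_rpow hne, ofReal_zero, zero_div]
    have hs' : ∀ n ∈ Finset.Icc 1 ⌊-a / 2⌋₊, sinTerm a 0 n = 0 := by
      intro n hn
      have : (1 : ℝ) ≤ n := by exact_mod_cast (Finset.mem_Icc.mp hn).1
      have hne : -(n : ℝ) / (2 * a) ≠ 0 :=
        div_ne_zero (by linarith) (by linarith)
      simp only [sinTerm, Real.zero_rpow hne, ofReal_zero, zero_div]
    refine ⟨(integrable_zero _ _ _).congr (zetaKernel_zero_ae a).symm, ?_, ?_⟩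
    · simp only [hs]; exact summable_zero
    · rw [integral_congr_ae (zetaKernel_zero_ae a), Finset.sum_eq_zero hs']
      simp [hs]
  · have hsum := summable_residueTerm ha hw hw1
    have hterm : ∀ n : Set.Ici ⌈-a / 2⌉₊, sinhTerm a w n = -4 * I * residueTerm a w n := by
      rintro ⟨n, hn⟩
      rw [residueTerm_eq_sinhTerm ha hw (hN n hn)]
      linear_combination sinhTerm a w n * I_sq
    have hζ : riemannZeta (a : ℂ) ≠ 0 := by
      intro h
      obtain ⟨n, -, hn⟩ := eq_neg_two_mul_of_riemannZeta_eq_zero (by simpa using ha.le) h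
      refine hk (2 * n) ?_
      have : (a : ℂ) = ((-2 * n : ℝ) : ℂ) := by rw [hn]; push_cast; ring
      rw [ofReal_inj.mp this]; push_cast; ring
    refine ⟨integrable_zetaKernel ha hw hw1, ?_, ?_⟩
    · simp only [hterm]
      exact (hsum.subtype _).mul_left _
    · have hset : ((Finset.range ⌈-a / 2⌉₊ : Finset ℕ) : Set ℕ)ᶜ = Set.Ici ⌈-a / 2⌉₊ := by
        ext; simp
      have h1 := hsum.sum_add_tsum_compl (s := Finset.range ⌈-a / 2⌉₊)
      rw [hset] at h1
      -- As `-a/2` is not an integer, the indices below its ceiling are 0, with zero term, and those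
      -- from 1 to its floor.
      have h2 : ∑ n ∈ Finset.range ⌈-a / 2⌉₊, residueTerm a w n =
          ∑ n ∈ Finset.Icc 1 ⌊-a / 2⌋₊, -(I / 4 * sinTerm a w n) := by
        have hsub : Finset.Icc 1 ⌊-a / 2⌋₊ ⊆ Finset.range ⌈-a / 2⌉₊ := by
          intro n hn
          rw [Finset.mem_range]
          by_contra hc
          have h3 := hN n (not_lt.mp hc)
          have h4 := (Nat.le_floor_iff (by linarith)).mp (Finset.mem_Icc.mp hn).2
          linarith
        rw [← Finset.sum_subset hsub]
        · refine Finset.sum_congr rfl fun n hn => ?_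
          refine residueTerm_eq_sinTerm ha hw (Finset.mem_Icc.mp hn).1 ?_
          have := Nat.lt_ceil.mp (Finset.mem_range.mp (hsub hn))
          linarith
        · intro n hn hn'
          rcases Nat.eq_zero_or_pos n with rfl | hpos
          · exact residueTerm_zero a w
          · exact absurd (Finset.mem_Icc.mpr ⟨hpos, Nat.le_floor
              (Nat.lt_ceil.mp (Finset.mem_range.mp hn)).le⟩) hn'
      rw [integral_zetaKernel_eq ha hw hw1 (tendsto_mul_stripKernel_simple ha hw hζ), ← h1, h2]
      simp only [hterm]
      rw [tsum_mul_left, Finset.sum_neg_distrib, ← Finset.mul_sum]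
      have hpi : (Real.pi : ℂ) ≠ 0 := ofReal_ne_zero.mpr Real.pi_ne_zero
      generalize ∑ n ∈ Finset.Icc 1 ⌊-a / 2⌋₊, sinTerm a w n = S
      generalize ∑' n : Set.Ici ⌈-a / 2⌉₊, residueTerm a w n = T
      field_simp
      linear_combination (-8 * ((w ^ (1 / 4 : ℝ) : ℝ) : ℂ) + 4 * Real.pi * S * riemannZeta a) * I_sq

lemma sinhTerm_eq_limitSinhTerm {m : ℕ} (hm : 1 ≤ m) (w : ℝ) (n : ℕ) :
    sinhTerm (-2 * (m : ℝ)) w (n + (m + 1)) =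
      -(limitSinhTerm m w n / (2 * ((√(m : ℝ) : ℝ) : ℂ))) := by
  have hm0 : (0 : ℝ) < m := by exact_mod_cast hm
  have hmne := hm0.ne'
  have hsm : 0 < √(m : ℝ) := Real.sqrt_pos.mpr hm0
  have hsq : √(m : ℝ) * √(m : ℝ) = m := Real.mul_self_sqrt hm0.le
  have h1 : √(-(-2 * (m : ℝ)) ^ 2 - 2 * (-2 * (m : ℝ)) * ((n + (m + 1) : ℕ) : ℝ)) =
      2 * √(m : ℝ) * √((n : ℝ) + 1) := by
    have : -(-2 * (m : ℝ)) ^ 2 - 2 * (-2 * (m : ℝ)) * ((n + (m + 1) : ℕ) : ℝ) =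
        2 ^ 2 * (m * ((n : ℝ) + 1)) := by push_cast; ring
    rw [this, Real.sqrt_mul (by norm_num), Real.sqrt_mul hm0.le, Real.sqrt_sq (by norm_num),
      mul_assoc]
  have h2 : Real.pi * (2 * √(m : ℝ) * √((n : ℝ) + 1)) / (2 * (-2 * (m : ℝ))) =
      -(Real.pi * √(1 + (n : ℝ)) / (2 * √(m : ℝ))) := by
    rw [add_comm (n : ℝ) 1]
    field_simp
    linear_combination -hsq
  have h3 : -((n + (m + 1) : ℕ) : ℝ) / (2 * (-2 * (m : ℝ))) = ((n : ℝ) + 1 + m) / (4 * m) := by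
    push_cast; field_simp; ring
  have h4 : (-2 * ((n + (m + 1) : ℕ) : ℂ)) = -2 * (n : ℂ) - 2 * (m : ℂ) - 2 := by
    push_cast; ring
  rw [sinhTerm, limitSinhTerm, h1, h2, h3, h4, Real.sinh_neg]
  push_cast
  rw [div_div, ← div_neg]
  congr 1
  ring

lemma sinTerm_eq_limitSinTerm {m : ℕ} (hm : 1 ≤ m) (w : ℝ) (n : ℕ) :
    sinTerm (-2 * (m : ℝ)) w n = -(limitSinTerm m w n / 2) := by
  have hm0 : (0 : ℝ) < m := by exact_mod_cast hm
  have hmne := hm0.ne'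
  have h1 : √((-2 * (m : ℝ)) ^ 2 + 2 * (-2 * (m : ℝ)) * n) = 2 * √((m : ℝ) ^ 2 - m * n) := by
    have : (-2 * (m : ℝ)) ^ 2 + 2 * (-2 * (m : ℝ)) * n = 2 ^ 2 * ((m : ℝ) ^ 2 - m * n) := by ring
    rw [this, Real.sqrt_mul (by norm_num), Real.sqrt_sq (by norm_num)]
  have h0 : √((m : ℝ) ^ 2 - m * n) = m * √(1 - (n : ℝ) / m) := by
    have : (m : ℝ) ^ 2 - m * n = m ^ 2 * (1 - (n : ℝ) / m) := by field_simp
    rw [this, Real.sqrt_mul (by positivity), Real.sqrt_sq hm0.le]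
  have h2 : Real.pi * (2 * √((m : ℝ) ^ 2 - m * n)) / (2 * (-2 * (m : ℝ))) =
      -(Real.pi / 2 * √(1 - (n : ℝ) / m)) := by
    rw [h0]
    field_simp
  have h3 : -(n : ℝ) / (2 * (-2 * (m : ℝ))) = (n : ℝ) / (4 * m) := by
    field_simp; ring
  rw [sinTerm, limitSinTerm, h1, h2, h3, Real.sin_neg]
  push_cast
  rw [div_div, ← div_neg]
  congr 1
  ring

theorem integral_zetaKernel_neg_even {w : ℝ} (hw0 : 0 ≤ w) (hw1 : w ≤ 1) {m : ℕ} (hm : 1 ≤ m) :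
    Integrable (zetaKernel (-2 * (m : ℝ)) w) ∧
      Summable (limitSinhTerm m w) ∧
      ∫ v : ℝ, zetaKernel (-2 * (m : ℝ)) w v =
        -(1 / 8 : ℂ) * (((w ^ (1 / 4 : ℝ) * Real.log w : ℝ) : ℂ) /
            ((m : ℂ) * deriv riemannZeta (-2 * (m : ℂ))))
          + (1 / 48 : ℂ) * (((Real.pi ^ 2 * w ^ (1 / 4 : ℝ) : ℝ) : ℂ) /
            ((m : ℂ) * deriv riemannZeta (-2 * (m : ℂ))))
          - (1 / 2 : ℂ) * (((w ^ (1 / 4 : ℝ) : ℝ) : ℂ) *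
            iteratedDeriv 2 riemannZeta (-2 * (m : ℂ)) /
            (deriv riemannZeta (-2 * (m : ℂ))) ^ 2)
          - (Real.pi : ℂ) / (4 * ((Real.sqrt (m : ℝ) : ℝ) : ℂ)) *
            ∑' n : ℕ, limitSinhTerm m w n
          + (Real.pi : ℂ) / 4 * ∑ n ∈ Finset.Icc 1 (m - 1), limitSinTerm m w n := by
  have hm0 : (0 : ℝ) < m := by exact_mod_cast hm
  have hmC : (m : ℂ) ≠ 0 := by exact_mod_cast hm0.ne'
  rcases hw0.eq_or_lt with rfl | hw
  · have hs : ∀ n, limitSinhTerm m 0 n = 0 := by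
      intro n
      have hne : ((n : ℝ) + 1 + m) / (4 * m) ≠ 0 := by positivity
      simp only [limitSinhTerm, Real.zero_rpow hne, ofReal_zero, zero_div]
    have hs' : ∀ n ∈ Finset.Icc 1 (m - 1), limitSinTerm m 0 n = 0 := by
      intro n hn
      have : (1 : ℝ) ≤ n := by exact_mod_cast (Finset.mem_Icc.mp hn).1
      have hne : (n : ℝ) / (4 * m) ≠ 0 := by positivity
      simp only [limitSinTerm, Real.zero_rpow hne, ofReal_zero, zero_div]
    refine ⟨(integrable_zero _ _ _).congr (zetaKernel_zero_ae _).symm, ?_, ?_⟩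
    · rw [show limitSinhTerm m 0 = fun _ => 0 from funext hs]; exact summable_zero
    · rw [integral_congr_ae (zetaKernel_zero_ae _), Finset.sum_eq_zero hs']
      simp [hs]
  · set a : ℝ := -2 * (m : ℝ) with ha_def
    have ha : a < 0 := by linarith
    have haC : (a : ℂ) = -2 * (m : ℂ) := by rw [ha_def]; push_cast; ring
    have hsum := summable_residueTerm ha hw hw1
    have hsm : ((√(m : ℝ) : ℝ) : ℂ) ≠ 0 := ofReal_ne_zero.mpr (Real.sqrt_pos.mpr hm0).ne'
    have hterm : ∀ n : ℕ, residueTerm a w (n + (m + 1)) =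
        -(I / (8 * ((√(m : ℝ) : ℝ) : ℂ))) * limitSinhTerm m w n := by
      intro n
      have h1 : -a < 2 * ((n + (m + 1) : ℕ) : ℝ) := by
        rw [ha_def]; push_cast; linarith [(Nat.cast_nonneg n : (0 : ℝ) ≤ n)]
      rw [residueTerm_eq_sinhTerm ha hw h1, sinhTerm_eq_limitSinhTerm hm]
      field_simp
      ring
    have hc : -(I / (8 * ((√(m : ℝ) : ℝ) : ℂ))) ≠ 0 :=
      neg_ne_zero.mpr (div_ne_zero I_ne_zero (mul_ne_zero (by norm_num) hsm))
    have hshift : Summable fun n : ℕ => residueTerm a w (n + (m + 1)) :=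
      (summable_nat_add_iff (m + 1)).mpr hsum
    refine ⟨integrable_zetaKernel ha hw hw1, ?_, ?_⟩
    · simp only [hterm] at hshift
      exact (summable_mul_left_iff hc).mp hshift
    · have h1 := hsum.sum_add_tsum_nat_add (m + 1)
      -- The index `m` contributes nothing here: its pole is 0, already accounted for by the triple
      -- pole.
      have h2 : ∑ n ∈ Finset.range (m + 1), residueTerm a w n =
          ∑ n ∈ Finset.Icc 1 (m - 1), I / 8 * limitSinTerm m w n := by
        have hsub : Finset.Icc 1 (m - 1) ⊆ Finset.range (m + 1) := by
          intro n hn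
          rw [Finset.mem_Icc] at hn
          rw [Finset.mem_range]
          lia
        rw [← Finset.sum_subset hsub]
        · refine Finset.sum_congr rfl fun n hn => ?_
          obtain ⟨hn1, hn2⟩ := Finset.mem_Icc.mp hn
          have hnm : n < m := by lia
          have hnm' : (n : ℝ) < m := by exact_mod_cast hnm
          rw [residueTerm_eq_sinTerm ha hw hn1 (by linarith), sinTerm_eq_limitSinTerm hm w n]
          ring
        · intro n hn hn'
          rw [Finset.mem_range] at hn
          rw [Finset.mem_Icc] at hn'
          have : n = 0 ∨ n = m := by lia
          rcases this with rfl | rfl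
          · exact residueTerm_zero a w
          · rw [residueTerm, if_neg]
            rintro ⟨-, h⟩
            exact h (by rw [ha_def]; ring)
      have hζ : riemannZeta (a : ℂ) = 0 := by
        rw [haC]; exact riemannZeta_neg_two_mul_eq_zero hm
      have hζ' : deriv riemannZeta (a : ℂ) ≠ 0 := by
        rw [haC]; exact deriv_riemannZeta_neg_two_mul_ne_zero hm
      rw [integral_zetaKernel_eq ha hw hw1 (tendsto_mul_stripKernel_triple ha hw hζ hζ'), ← h1, h2]
      simp only [hterm]
      rw [tsum_mul_left, ← Finset.mul_sum]
      have hpi : (Real.pi : ℂ) ≠ 0 := ofReal_ne_zero.mpr Real.pi_ne_zero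
      rw [haC] at hζ' ⊢
      generalize ∑ n ∈ Finset.Icc 1 (m - 1), limitSinTerm m w n = S
      generalize ∑' n : ℕ, limitSinhTerm m w n = T
      generalize deriv riemannZeta (-2 * (m : ℂ)) = Z at *
      generalize iteratedDeriv 2 riemannZeta (-2 * (m : ℂ)) = Z2
      push_cast
      generalize ((w ^ (1 / 4 : ℝ) : ℝ) : ℂ) = W
      generalize ((Real.log w : ℝ) : ℂ) = L
      generalize ((√(m : ℝ) : ℝ) : ℂ) = q at *
      have hI : ∀ x y : ℂ, -Real.pi * I * (I * x + 2 * (I * y)) = Real.pi * (x + 2 * y) :=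
        fun x y => by linear_combination (-Real.pi * (x + 2 * y)) * I_sq
      have e : I / 8 * S + -(I / (8 * q)) * T = I * (S / 8 - T / (8 * q)) := by ring
      rw [e, mul_assoc I, hI]
      field_simp
      ring

end

theorem mainTheorem3 (w : ℝ) (hw0 : 0 ≤ w) (hw1 : w ≤ 1) :
    (∀ a : ℝ, a < 0 → (∀ k : ℕ, a ≠ -(k : ℝ)) →
      MeasureTheory.Integrable (zetaKernel a w) ∧
      Summable (fun n : Set.Ici ⌈-a / 2⌉₊ => sinhTerm a w n) ∧
      ∫ v : ℝ, zetaKernel a w v =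
        ((w ^ (1 / 4 : ℝ) : ℝ) : ℂ) / riemannZeta (a : ℂ)
          + (Real.pi : ℂ) / 2 * ∑' n : Set.Ici ⌈-a / 2⌉₊, sinhTerm a w n
          - (Real.pi : ℂ) / 2 * ∑ n ∈ Finset.Icc 1 ⌊-a / 2⌋₊, sinTerm a w n) ∧
    (∀ m : ℕ, 1 ≤ m →
      MeasureTheory.Integrable (zetaKernel (-2 * (m : ℝ)) w) ∧
      Summable (limitSinhTerm m w) ∧
      ∫ v : ℝ, zetaKernel (-2 * (m : ℝ)) w v =
        -(1 / 8 : ℂ) * (((w ^ (1 / 4 : ℝ) * Real.log w : ℝ) : ℂ) /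
            ((m : ℂ) * deriv riemannZeta (-2 * (m : ℂ))))
          + (1 / 48 : ℂ) * (((Real.pi ^ 2 * w ^ (1 / 4 : ℝ) : ℝ) : ℂ) /
            ((m : ℂ) * deriv riemannZeta (-2 * (m : ℂ))))
          - (1 / 2 : ℂ) * (((w ^ (1 / 4 : ℝ) : ℝ) : ℂ) *
            iteratedDeriv 2 riemannZeta (-2 * (m : ℂ)) /
            (deriv riemannZeta (-2 * (m : ℂ))) ^ 2)
          - (Real.pi : ℂ) / (4 * ((Real.sqrt (m : ℝ) : ℝ) : ℂ)) *
            ∑' n : ℕ, limitSinhTerm m w n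
          + (Real.pi : ℂ) / 4 * ∑ n ∈ Finset.Icc 1 (m - 1), limitSinTerm m w n) :=
  ⟨fun _ ha hk => integral_zetaKernel_generic hw0 hw1 ha hk,
    fun _ hm => integral_zetaKernel_neg_even hw0 hw1 hm⟩
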